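/- **Setting.** Let $V$ be a finite set of binary variables. A labeled DAG (LDAG) $G$ on $V$ is a DAG in which each edge $u\to v$ carries a label, a (possibly empty) set of assignments to $pa(v)\setminus\{u\}$. A model of $G$ is a positive causal Bayesian network with DAG $G$ whose conditional probabilities satisfy $P(v\mid pa(v))=P(v\mid pa(v)\setminus\{u\})$ whenever the assignment to $pa(v)\setminus\{u\}$ is in the label of $u\to v$; $P(Y\mid \mathrm{do}(X),Z)$ is defined by truncated factorization. Let $Y,X,Z\subseteq W\subseteq V$ with $Y,X,Z$ pairwise disjoint; $W$ is the set of observed variables. The augmented LDAG has an additional node $I_v$ and an unlabeled edge $I_v\to v$ for each $v\in V$; the label of an edge $u\to v$ of $G$ becomes the set of assignments with $I_v=1$ or whose restriction to $V$ is in the old label. A *term* $P(Y_1,y_2\mid X_1,x_2)$ has disjoint sets of nodes of the augmented LDAG on the two sides, not all of them on the right; capital letters stand for all values, small letters for a fixed value. The input is $P(W)=P(W\mid I_V=0)$ and the target is $Q=P(Y\mid X,Z,I_X=1,I_{V\setminus X}=0)$, which encodes $P(Y\mid\mathrm{do}(X),Z)$. **Rules.** (1) $P(Y_1,y_2\mid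 Z_1,z_2,X_1,x_2)=P(Y_1,y_2\mid X_1,x_2)$ if $Y_1,Y_2\perp Z_1,Z_2\mid X_1,x_2$, in both directions. The others are used from right to left, and in 5–8 the set $Z$ is a singleton: (2) $P(Y_1,y_2\mid X_1,x_2)=\sum_Z P(Y_1,y_2,Z\mid X_1,x_2)$; (3) $P(Y_1\mid Z_1,z_2,X_1,x_2)=P(Y_1,Z_1,z_2\mid X_1,x_2)/\sum_{Y_1}P(Y_1,Z_1,z_2\mid X_1,x_2)$; (4) $P(Y_1,y_2,Z_1,z_2\mid X_1,x_2)=P(Y_1,y_2\mid Z_1,z_2,X_1,x_2)P(Z_1,z_2\mid X_1,x_2)$; (5) $P(Y_1,y_2,1-z\mid X_1,x_2)=P(Y_1,y_2\mid X_1,x_2)-P(Y_1,y_2,z\mid X_1,x_2)$, where the first term on the right is the constant $1$ if $Y_1,Y_2$ are empty; (6) $P(Y_1,y_2,Z\mid X_1,x_2)$ is obtained by cases from its instances at $Z=0$ and $Z=1$; (7), (8) an instance $Z=z$ is obtained from the term for all $Z$, with $Z$ on the left or on the right of the bar. **CSI test.** The context $s$ specific DAG drops $u\to v$ if all assignments to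 $pa(v)\setminus\{u\}$ that agree with $s$ are in its label. The statement $Y\perp Z\mid X,w$ passes if (a) it is the local CSI of an edge and encoded in its label; or (b) $Y,Z$ are d-separated given $X$ and the variables of $w$ in the context $w$ specific DAG; or (c) there is a nonempty set $C$ of nodes not in $Y,Z,X$, not assigned by $w$, and not in a set $C$ chosen earlier in the same branch of the recursion, such that $Y\perp Z\mid X,w,c$ holds by (b) for one representative $c$ of each class of assignments to $C$ (two are equivalent if, together with $w$, they give the same context-specific DAG), and one of $Y\perp C\mid X,w$; $C\perp Z\mid X,w$; $Y\perp C\mid X,Z,w$; $Z\perp C\mid X,Y,w$ passes the test recursively. **Search.** The set $\mathbf I$ of identified terms and the set $\mathbf U$ of unexpanded terms are initially $\{P(W)\}$. While $\mathbf U\neq\emptyset$: take the term $P'\in\mathbf U$ of largest value of a given proximity function (ties: the one identified first). For each term $P^*$ that can be derived from $P'$ by one application of a rule, possibly with a second term as additional premise: skip it if $P^*\in\mathbf I$, if the additional premise is not in $\mathbf I$, or if the CSI statement required by rule 1 fails the test; otherwise, if $P^*=Q$, return the expression $F$ for $Q$ obtained by backtracking the derivation to $P(W)$; else add $P^*$ to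 $\mathbf I$ and $\mathbf U$. Then remove $P'$ from $\mathbf U$. If $\mathbf U$ becomes empty, return NA. **Theorem.** For every $G,W,Y,X,Z$ as above, every proximity function, every order in which the candidates are processed and every choice of representatives, the search (including the recursive CSI tests) terminates. If it returns an expression $F$ over $P(W)$, then $F$ is correct: in every model of $G$, the value of $F$ computed from the distribution $P(W)$ of that model equals $P(Y\mid\mathrm{do}(X),Z)$, for all values of the variables. -/

import Mathlib

/-- A labeled DAG over binary variables: the label of an edge `u → v` is a set of assignments to
the other parents of `v` (the values of `label` at pairs that are not edges are never used). -/
structure LDAG (N : Type*) where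
  edge : N → N → Prop
  acyclic : ∀ v, ¬ Relation.TransGen edge v v
  label : ∀ u v : N, Set ({w : N // edge w v ∧ w ≠ u} → Bool)

namespace LDAG

/-! ### Causal models that are compatible with a labeled DAG -/

/-- A positive causal Bayesian network with the structure of `G`; `prob v a` is the probability
of `v = 1` given that the parents of `v` have the values that they have in `a`. -/
structure CausalModel {V : Type*} (G : LDAG V) where
  prob : V → (V → Bool) → ℝ
  prob_pos : ∀ v a, 0 < prob v a
  prob_lt_one : ∀ v a, prob v a < 1
  prob_parents : ∀ v a b, (∀ u, G.edge u v → a u = b u) → prob v a = prob v b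
  prob_label : ∀ u v, G.edge u v → ∀ a b : V → Bool, (∀ w, w ≠ u → a w = b w) →
    (fun w : {w : V // G.edge w v ∧ w ≠ u} => a w.1) ∈ G.label u v → prob v a = prob v b

namespace CausalModel

variable {V : Type*} [Fintype V] [DecidableEq V] {G : LDAG V}

/-- The conditional probability of the value `a v` of `v` given the values of its parents. -/
def cpd (M : G.CausalModel) (v : V) (a : V → Bool) : ℝ :=
  if a v then M.prob v a else 1 - M.prob v a

/-- The joint distribution of all variables in the passive observational state. -/
def joint (M : G.CausalModel) (a : V → Bool) : ℝ := ∏ v, M.cpd v a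

/-- The distribution `P(W)` of the observed variables. -/
def observed (M : G.CausalModel) (W : Finset V) (w : {v // v ∈ W} → Bool) : ℝ :=
  ∑ a : V → Bool with ∀ v : {v // v ∈ W}, a v.1 = w v, M.joint a

/-- The joint distribution after the intervention that sets every `v ∈ X` to `x v`
(truncated factorization). -/
def doJoint (M : G.CausalModel) (X : Finset V) (x a : V → Bool) : ℝ :=
  if ∀ v ∈ X, a v = x v then ∏ v ∈ Xᶜ, M.cpd v a else 0

/-- The causal effect `P(Y | do(X), Z)`, where `Y`, `X`, `Z` have the values they have in `a`. -/
noncomputable def effect (M : G.CausalModel) (Y X Z : Finset V) (a : V → Bool) : ℝ :=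
  (∑ b : V → Bool with ∀ v ∈ Y ∪ Z, b v = a v, M.doJoint X a b) /
    ∑ b : V → Bool with ∀ v ∈ Z, b v = a v, M.doJoint X a b

end CausalModel

/-! ### Intervention nodes -/

/-- The edges of the augmented LDAG: `Sum.inl v` is the variable `v`, and `Sum.inr v` is its
intervention node. -/
def augEdge {V : Type*} (G : LDAG V) : V ⊕ V → V ⊕ V → Prop
  | .inl u, .inl v => G.edge u v
  | .inr u, .inl v => u = v
  | _, .inr _ => False

theorem augEdge_transGen {V : Type*} (G : LDAG V) {x y : V ⊕ V}
    (h : Relation.TransGen G.augEdge x y) :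
    ∃ v, y = .inl v ∧ ∀ u, x = .inl u → Relation.TransGen G.edge u v := by
  induction h with
  | @single y h =>
    rcases y with v | v
    · refine ⟨v, rfl, ?_⟩
      rintro u rfl
      exact .single h
    · cases x <;> exact h.elim
  | @tail y z _ h ih =>
    obtain ⟨w, rfl, hw⟩ := ih
    rcases z with v | v
    · exact ⟨v, rfl, fun u hu => (hw u hu).tail h⟩
    · exact h.elim

/-- The augmented LDAG. The label of an edge `u → v` between variables contains an assignment if
`I_v = 1` in it, or if its restriction is in the original label; edges `I_v → v` are unlabeled. -/
def augment {V : Type*} (G : LDAG V) : LDAG (V ⊕ V) where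
  edge := G.augEdge
  acyclic := by
    intro x h
    obtain ⟨v, rfl, hv⟩ := G.augEdge_transGen h
    exact G.acyclic v (hv v rfl)
  label
    | .inl u, .inl v => {l | l ⟨.inr v, rfl, Sum.inr_ne_inl⟩ = true ∨
        (fun w : {w : V // G.edge w v ∧ w ≠ u} =>
          l ⟨.inl w.1, w.2.1, fun h => w.2.2 (Sum.inl_injective h)⟩) ∈ G.label u v}
    | _, _ => ∅

/-! ### Context-specific DAGs and separation -/

/-- The context `s` specific DAG: the edge `u → v` is dropped if every assignment to the other
parents of `v` that agrees with the context is in its label. -/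
def ctxEdge {N : Type*} (G : LDAG N) (s : N → Option Bool) (u v : N) : Prop :=
  G.edge u v ∧ ¬ ∀ l : {w : N // G.edge w v ∧ w ≠ u} → Bool,
    (∀ w b, s w.1 = some b → l w = b) → l ∈ G.label u v

end LDAG

/-- `ActiveWalk E S x a b`: in the directed graph `E` there is a walk (edges may be traversed in
both directions) that starts in `x`, whose last step is from `a` to `b`, and that is not blocked
by `S`: each inner node that is a collider on the walk has a descendant (or is itself) in `S`, and
the other inner nodes are not in `S`. -/
inductive ActiveWalk {N : Type*} (E : N → N → Prop) (S : Set N) (x : N) : N → N → Prop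
  | start {b : N} : E x b ∨ E b x → ActiveWalk E S x x b
  | collider {a b c : N} : ActiveWalk E S x a b → E a b → E c b →
      (∃ d ∈ S, Relation.ReflTransGen E b d) → ActiveWalk E S x b c
  | nonCollider {a b c : N} : ActiveWalk E S x a b → (E b c ∨ E c b) → ¬ (E a b ∧ E c b) →
      b ∉ S → ActiveWalk E S x b c

/-- d-separation of (disjoint) sets of nodes `Y` and `Z` given `S` in the DAG `E`. -/
def DSeparated {N : Type*} (E : N → N → Prop) (Y Z S : Set N) : Prop :=
  ∀ y ∈ Y, ∀ z ∈ Z, ∀ a, ¬ ActiveWalk E S y a z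

/-- A CSI statement `left ⊥ right | cond, ctx`, where `ctx` assigns values to some variables. -/
structure CSI (N : Type*) where
  left : Finset N
  right : Finset N
  cond : Finset N
  ctx : N → Option Bool

/-- The context `w` together with an assignment `c` to the variables `C`. -/
def extendCtx {N : Type*} [DecidableEq N] (w : N → Option Bool) (C : Finset N)
    (c : {v // v ∈ C} → Bool) : N → Option Bool :=
  fun v => if h : v ∈ C then some (c ⟨v, h⟩) else w v

namespace LDAG

variable {N : Type*} (G : LDAG N)

/-- The statement is the local CSI of an edge `u → v` and it is directly encoded in the label: the
variables conditioned on are the other parents of `v`, and all their assignments that agree with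
the context are in the label. -/
def InLabel (s : CSI N) : Prop :=
  ∃ u v, G.edge u v ∧ ((s.left = {v} ∧ s.right = {u}) ∨ (s.left = {u} ∧ s.right = {v})) ∧
    (∀ x, (x ∈ s.cond ∨ s.ctx x ≠ none) ↔ (G.edge x v ∧ x ≠ u)) ∧
    ∀ l : {w : N // G.edge w v ∧ w ≠ u} → Bool,
      (∀ w b, s.ctx w.1 = some b → l w = b) → l ∈ G.label u v

/-- The CSI-separation criterion: d-separation given the conditioning set and the variables of the
context, in the context-specific DAG. -/
def CSISeparated (s : CSI N) : Prop :=
  DSeparated (G.ctxEdge s.ctx) s.left s.right {x | x ∈ s.cond ∨ s.ctx x ≠ none}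

/-- Assignments to `C` are equivalent in the context `w` if, together with `w`, they give the same
context-specific DAG. -/
def ctxSetoid [DecidableEq N] (w : N → Option Bool) (C : Finset N) :
    Setoid ({v // v ∈ C} → Bool) :=
  Setoid.ker fun c => G.ctxEdge (extendCtx w C c)

end LDAG

/-! ### Terms and expressions -/

/-- The role of a variable in a term `P(Y₁, y₂ | X₁, x₂)`. The argument is `none` if the term is
for all values of the variable (a large letter), and `some b` if the variable is set to `b`. -/
inductive Role
  | absent
  | left (o : Option Bool)
  | right (o : Option Bool)
  deriving DecidableEq, Fintype

/-- A term `P(Y₁, y₂ | X₁, x₂)` over the nodes `N`. -/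
abbrev Term (N : Type*) := N → Role

/-- Expressions over the input distribution `P(W)`. -/
inductive Formula (N : Type*)
  | input : Formula N
  | one : Formula N
  | sub : Formula N → Formula N → Formula N
  | mul : Formula N → Formula N → Formula N
  | div : Formula N → Formula N → Formula N
  | sum : Finset N → Formula N → Formula N
  | subst : N → Bool → Formula N → Formula N
  | cases : N → Formula N → Formula N → Formula N

/-- The value of an expression for the input distribution `p` and the values `a` of the
variables. -/
noncomputable def Formula.eval {V : Type*} [Fintype V] [DecidableEq V] {W : Finset V}
    (p : ({v // v ∈ W} → Bool) → ℝ) : Formula (V ⊕ V) → (V ⊕ V → Bool) → ℝ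
  | .input, a => p fun v => a (.inl v.1)
  | .one, _ => 1
  | .sub f g, a => f.eval p a - g.eval p a
  | .mul f g, a => f.eval p a * g.eval p a
  | .div f g, a => f.eval p a / g.eval p a
  | .sum S f, a => ∑ b : V ⊕ V → Bool with ∀ v, v ∉ S → b v = a v, f.eval p b
  | .subst v b f, a => f.eval p (Function.update a v b)
  | .cases v f g, a => if a v = false then f.eval p a else g.eval p a

namespace Term

variable {N : Type*}

/-- A term has at least one variable on the left of the conditioning bar. -/
def Proper (t : Term N) : Prop := ∃ v o, t v = .left o

/-- `long = P(Y₁, y₂ | Z₁, z₂, X₁, x₂)` and `short = P(Y₁, y₂ | X₁, x₂)`. -/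
def Rule1 (long short : Term N) : Prop :=
  ∀ v, long v = short v ∨ (short v = .absent ∧ ∃ o, long v = .right o)

/-- `concl = P(Y₁, y₂ | X₁, x₂)` and `prem = P(Y₁, y₂, Z | X₁, x₂)`. -/
def Rule2 (concl prem : Term N) : Prop :=
  ∀ v, concl v = prem v ∨ (prem v = .left none ∧ concl v = .absent)

/-- `concl = P(Y₁ | Z₁, z₂, X₁, x₂)` and `prem = P(Y₁, Z₁, z₂ | X₁, x₂)`. -/
def Rule3 (concl prem : Term N) : Prop :=
  (∀ v, concl v = prem v ∨ ∃ o, prem v = .left o ∧ concl v = .right o) ∧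
    ∀ v b, concl v ≠ .left (some b)

/-- `concl = P(Y₁, y₂, Z₁, z₂ | X₁, x₂)`, `fst = P(Y₁, y₂ | Z₁, z₂, X₁, x₂)` and
`snd = P(Z₁, z₂ | X₁, x₂)`. -/
def Rule4 (concl fst snd : Term N) : Prop :=
  ∀ v, (∃ o, concl v = .left o ∧ fst v = .left o ∧ snd v = .absent) ∨
    (∃ o, concl v = .left o ∧ fst v = .right o ∧ snd v = .left o) ∨
    ((∀ o, concl v ≠ .left o) ∧ fst v = concl v ∧ snd v = concl v)

variable [DecidableEq N]

/-- `concl = P(Y₁, y₂, 1 - z | X₁, x₂)`, `all = P(Y₁, y₂ | X₁, x₂)` and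
`case = P(Y₁, y₂, z | X₁, x₂)`, where the variable `v` has the value `z` in `case`. -/
def Rule5 (v : N) (z : Bool) (concl all case : Term N) : Prop :=
  case v = .left (some z) ∧ concl = Function.update case v (.left (some (!z))) ∧
    all = Function.update case v .absent

/-- `concl = P(Y₁, y₂, Z | X₁, x₂)`, and `case0`, `case1` are this term with `Z = 0`, `Z = 1`. -/
def Rule6 (v : N) (concl case0 case1 : Term N) : Prop :=
  concl v = .left none ∧ case0 = Function.update concl v (.left (some false)) ∧
    case1 = Function.update concl v (.left (some true))

/-- `prem = P(Y₁, y₂, Z | X₁, x₂)` and `concl = P(Y₁, y₂, z | X₁, x₂)`. -/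
def Rule7 (v : N) (z : Bool) (concl prem : Term N) : Prop :=
  prem v = .left none ∧ concl = Function.update prem v (.left (some z))

/-- `prem = P(Y₁, y₂ | X₁, x₂, Z)` and `concl = P(Y₁, y₂ | X₁, x₂, z)`. -/
def Rule8 (v : N) (z : Bool) (concl prem : Term N) : Prop :=
  prem v = .right none ∧ concl = Function.update prem v (.right (some z))

/-- The CSI relation that the insertion or deletion of observations requires. -/
def rule1CSI [Fintype N] (long short : Term N) : CSI N where
  left := {v | ∃ o, short v = .left o}
  right := {v | long v ≠ short v}
  cond := {v | short v = .right none}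
  ctx v := match short v with
    | .right (some b) => some b
    | _ => none

end Term

/-! ### Candidates -/

/-- The rules, together with the part that the expanded term plays in the rule when there are two
premises. -/
inductive RuleName (N : Type*)
  | r1Insert
  | r1Delete
  | r2
  | r3
  | r4First
  | r4Second
  | r5All (v : N) (z : Bool)
  | r5Case (v : N) (z : Bool)
  | r5Empty (v : N) (z : Bool)
  | r6Zero (v : N)
  | r6One (v : N)
  | r7 (v : N) (z : Bool)
  | r8 (v : N) (z : Bool)

/-- A candidate: the rule, the additional input that it requires (if any) and the derived term. -/
structure Candidate (N : Type*) where
  rule : RuleName N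
  extra : Option (Term N)
  concl : Term N

namespace Candidate

variable {N : Type*} [DecidableEq N]

/-- The candidate is obtained when the rule is applied to the term `t`. The rule `r5Empty` is
`P(1 - z | X₁, x₂) = 1 - P(z | X₁, x₂)`. -/
def Valid (t : Term N) (c : Candidate N) : Prop :=
  c.concl.Proper ∧ match c.rule, c.extra with
    | .r1Insert, none => Term.Rule1 c.concl t
    | .r1Delete, none => Term.Rule1 t c.concl
    | .r2, none => Term.Rule2 c.concl t
    | .r3, none => Term.Rule3 c.concl t
    | .r4First, some u => Term.Rule4 c.concl t u
    | .r4Second, some u => Term.Rule4 c.concl u t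
    | .r5All v z, some u => Term.Rule5 v z c.concl t u
    | .r5Case v z, some u => Term.Rule5 v z c.concl u t
    | .r5Empty v z, none =>
      (∀ w o, w ≠ v → t w ≠ .left o) ∧ Term.Rule5 v z c.concl (Function.update t v .absent) t
    | .r6Zero v, some u => Term.Rule6 v c.concl t u
    | .r6One v, some u => Term.Rule6 v c.concl u t
    | .r7 v z, none => Term.Rule7 v z c.concl t
    | .r8 v z, none => Term.Rule8 v z c.concl t
    | _, _ => False

/-- The CSI relation that is required when the candidate is derived from `t`, if any. -/
def csi [Fintype N] (t : Term N) (c : Candidate N) : Option (CSI N) :=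
  match c.rule with
  | .r1Insert => some (Term.rule1CSI c.concl t)
  | .r1Delete => some (Term.rule1CSI t c.concl)
  | _ => none

/-- The right-hand side of the rule, with the expression `f` for the expanded term `t` and the
expression `g` for the additional input (not used if there is none). -/
def build [Fintype N] (t : Term N) (c : Candidate N) (f g : Formula N) : Formula N :=
  match c.rule with
  | .r1Insert => f
  | .r1Delete => f
  | .r2 => .sum {v | t v ≠ c.concl v} f
  | .r3 => .div f (.sum {v | c.concl v = .left none} f)
  | .r4First => .mul f g
  | .r4Second => .mul g f
  | .r5All _ _ => .sub f g
  | .r5Case _ _ => .sub g f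
  | .r5Empty _ _ => .sub .one f
  | .r6Zero v => .cases v f g
  | .r6One v => .cases v g f
  | .r7 v z => .subst v z f
  | .r8 v z => .subst v z f

end Candidate

/-! ### The search -/

/-- What the search is free to choose: the proximity function (larger is closer to the target),
the order in which the candidates that arise from a term are processed, and the representatives of
the classes of equivalent contexts. -/
structure Strategy {N : Type*} [DecidableEq N] (G : LDAG N) where
  proximity : Term N → ℝ
  candidates : Term N → List (Candidate N)
  mem_candidates : ∀ t c, c ∈ candidates t ↔ c.Valid t
  rep : ∀ (w : N → Option Bool) (C : Finset N),
    Quotient (G.ctxSetoid w C) → {v // v ∈ C} → Bool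
  mk_rep : ∀ (w : N → Option Bool) (C : Finset N) (q : Quotient (G.ctxSetoid w C)),
    Quotient.mk _ (rep w C q) = q

/-- The state of the search: the identified terms, each with the expression that results from
backtracking its derivation, and the list of unexpanded terms in the order of identification. -/
structure SearchState (N : Type*) where
  identified : Term N → Option (Formula N)
  unexpanded : List (Term N)

section Search

variable {N : Type*} [Fintype N] [DecidableEq N] {G : LDAG N}

open scoped Classical in
/-- The recursive test of a CSI statement `Y ⊥ Z | X, w`, with recursion depth at most the first
argument (`none` means that the recursion is not finished at this depth). After the label and the
CSI-separation criterion, sets `C` of fresh variables are tried for which `Y ⊥ Z | X, w, c` holds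
by CSI-separation for all representatives `c`, together with a recursive test of one of the
statements `Y ⊥ C | X, w`, `C ⊥ Z | X, w`, `Y ⊥ C | X, Z, w` and `Z ⊥ C | X, Y, w`. The set `used`
holds the variables of the sets `C` that were chosen in this branch of the recursion. -/
noncomputable def testCSI (σ : Strategy G) : ℕ → Finset N → CSI N → Option Bool
  | 0, _, _ => none
  | n + 1, used, s =>
    if G.InLabel s ∨ G.CSISeparated s then some true
    else
      (Finset.univ.filter fun C : Finset N => C.Nonempty ∧ Disjoint C used ∧ Disjoint C s.left ∧
          Disjoint C s.right ∧ Disjoint C s.cond ∧ ∀ v ∈ C, s.ctx v = none).toList.anyM fun C =>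
        if ∀ q, G.CSISeparated { s with ctx := extendCtx s.ctx C (σ.rep s.ctx C q) } then
          ([⟨s.left, C, s.cond, s.ctx⟩, ⟨C, s.right, s.cond, s.ctx⟩,
            ⟨s.left, C, s.cond ∪ s.right, s.ctx⟩,
            ⟨s.right, C, s.cond ∪ s.left, s.ctx⟩] : List (CSI N)).anyM
              fun s' => testCSI σ n (used ∪ C) s'
        else some false

/-- The expression for the additional input of a candidate: `none` if an additional input is
required that is not identified, and a dummy if no additional input is required. -/
def SearchState.extraFormula (st : SearchState N) (c : Candidate N) : Option (Formula N) :=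
  match c.extra with
  | none => some .one
  | some u => st.identified u

/-- Add a newly identified term with its expression; it is unexpanded. -/
def SearchState.add (st : SearchState N) (t : Term N) (f : Formula N) : SearchState N where
  identified := Function.update st.identified t (some f)
  unexpanded := st.unexpanded ++ [t]

/-- The loop over the candidates that are derived from the expanded term `t`. A candidate is
skipped if it is not new, if an additional input is required that is not identified, or if the
required CSI relation does not pass the test (with recursion depth `n`). The result is the new
state or the returned expression for the target `Q`; it is `none` if a test is not finished. -/
noncomputable def processCandidates (σ : Strategy G) (n : ℕ) (Q t : Term N) :
    List (Candidate N) → SearchState N → Option (SearchState N ⊕ Formula N)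
  | [], st => some (.inl st)
  | c :: cs, st =>
    match st.identified c.concl, st.identified t, st.extraFormula c with
    | none, some f, some g =>
      match (c.csi t).elim (some true) (testCSI σ n ∅) with
      | none => none
      | some false => processCandidates σ n Q t cs st
      | some true =>
        if c.concl = Q then some (.inr (c.build t f g))
        else processCandidates σ n Q t cs (st.add c.concl (c.build t f g))
    | _, _, _ => processCandidates σ n Q t cs st

/-- The main loop, with at most `m` iterations: expand the unexpanded term of maximal proximity
(among several the one that was identified first), and mark it as expanded. The result `none`
means that the computation is not finished, `some none` that the search returned NA, and
`some (some F)` that it returned the expression `F`. -/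
noncomputable def searchLoop (σ : Strategy G) (n : ℕ) (Q : Term N) :
    ℕ → SearchState N → Option (Option (Formula N))
  | 0, _ => none
  | m + 1, st =>
    match st.unexpanded.argmax σ.proximity with
    | none => some none
    | some t =>
      match processCandidates σ n Q t (σ.candidates t) st with
      | none => none
      | some (.inr F) => some (some F)
      | some (.inl st') =>
        searchLoop σ n Q m { st' with unexpanded := st'.unexpanded.erase t }

end Search

section Main

variable {V : Type*} [DecidableEq V]

/-- The input term `P(W)`: all intervention nodes are in the passive state. -/
def inputTerm (W : Finset V) : Term (V ⊕ V)
  | .inl v => if v ∈ W then .left none else .absent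
  | .inr _ => .right (some false)

/-- The target `P(Y | do(X), Z)`, that is `P(Y | X, Z, I_X = 1)` where the intervention nodes of
the variables outside `X` are in the passive state. -/
def targetTerm (Y X Z : Finset V) : Term (V ⊕ V)
  | .inl v => if v ∈ Y then .left none else if v ∈ X ∪ Z then .right none else .absent
  | .inr v => .right (some (decide (v ∈ X)))

/-- The search for `P(Y | do(X), Z)` from `P(W)` in the LDAG `G`, run with the bound `n` on the
number of iterations of the main loop and on the depth of the recursion in the CSI tests; the
result is `none` if the computation is not finished within these bounds. -/
noncomputable def search [Fintype V] (G : LDAG V) (σ : Strategy G.augment)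
    (W Y X Z : Finset V) (n : ℕ) : Option (Option (Formula (V ⊕ V))) :=
  searchLoop σ n (targetTerm Y X Z) n
    { identified := Function.update (fun _ => none) (inputTerm W) (some .input)
      unexpanded := [inputTerm W] }

end Main

/-! Soundness is reduced to statements about a single positive distribution. From a model of $G$ one
builds a model of the augmented LDAG in which every intervention node is a fair coin and a variable
whose intervention node is $1$ is a fair coin too. Fixing all intervention nodes turns its joint
distribution into the truncated factorization, up to a constant. Hence the input term has the value
$P(W)$ and the target term the value $P(Y\mid\mathrm{do}(X),Z)$ (`value_inputTerm`,
`value_targetTerm`). Rules 2-8 are identities between values of terms in any positive distribution,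
and rule 1 is one when its CSI statement holds (`Candidate.isCorrect_build`). By induction along the
search, the expression stored with a term evaluates to the value of that term. The search never sees
the model, so this applies to all models at once.

For the CSI test: in a context, each variable depends only on its parents in the context-specific
DAG. With the context variables frozen, the joint is therefore a Bayesian network over that DAG, and
the global Markov property (`DSeparated.condIndep`) applies. The label test is a special case of
this, and the recursive step is the contraction or the intersection property of positive
distributions.

For termination: each recursive call of the test uses up fresh nodes. In the search, the number of
unidentified terms plus the number of unexpanded terms is unchanged by an identification and drops
with each expansion. -/

/-! ### Partial sums, marginals and conditional independence. -/

section Marginals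

variable {N : Type*} [Fintype N] [DecidableEq N]

/-- The sum of `f` over all values of the variables in `C`; the other variables are fixed. -/
def sumOver (C : Finset N) (f : (N → Bool) → ℝ) (a : N → Bool) : ℝ :=
  ∑ b : N → Bool with ∀ v, v ∉ C → b v = a v, f b

theorem sumOver_congr {C : Finset N} {f g : (N → Bool) → ℝ} {a : N → Bool}
    (h : ∀ b, (∀ v, v ∉ C → b v = a v) → f b = g b) : sumOver C f a = sumOver C g a :=
  Finset.sum_congr rfl fun b hb => h b (by simpa using hb)

/-- In this form the index set no longer depends on `a`, so sums at different `a` can be compared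
term by term. -/
theorem sumOver_eq_sum (C : Finset N) (f : (N → Bool) → ℝ) (a : N → Bool) :
    sumOver C f a =
      ∑ c : {v // v ∈ C} → Bool, f fun v => if h : v ∈ C then c ⟨v, h⟩ else a v := by
  refine Finset.sum_nbij' (fun b v => b v.1) (fun c v => if h : v ∈ C then c ⟨v, h⟩ else a v)
    ?_ ?_ ?_ ?_ ?_
  · simp
  · intro c _
    simp only [Finset.mem_filter, Finset.mem_univ, true_and]
    intro v hv
    simp [hv]
  · intro b hb
    simp only [Finset.mem_filter, Finset.mem_univ, true_and] at hb
    funext v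
    by_cases hv : v ∈ C
    · simp [hv]
    · simp [hv, hb v hv]
  · intro c _
    funext v
    simp
  · intro b hb
    simp only [Finset.mem_filter, Finset.mem_univ, true_and] at hb
    congr 1
    funext v
    by_cases hv : v ∈ C
    · simp [hv]
    · simp [hv, hb v hv]

theorem sumOver_empty (f : (N → Bool) → ℝ) (a : N → Bool) : sumOver ∅ f a = f a := by
  rw [sumOver, Finset.sum_eq_single a]
  · intro b hb hba
    simp only [Finset.notMem_empty, not_false_eq_true, forall_const, Finset.mem_filter,
      Finset.mem_univ, true_and] at hb
    exact absurd (funext hb) hba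
  · simp

theorem sumOver_singleton (v : N) (f : (N → Bool) → ℝ) (a : N → Bool) :
    sumOver {v} f a = f (Function.update a v false) + f (Function.update a v true) := by
  have h : (Finset.univ.filter fun b : N → Bool => ∀ w, w ∉ ({v} : Finset N) → b w = a w) =
      {Function.update a v false, Function.update a v true} := by
    ext b
    simp only [Finset.mem_singleton, Finset.mem_filter, Finset.mem_univ, true_and,
      Finset.mem_insert]
    constructor
    · intro hb
      cases hv : b v
      · left
        funext w
        by_cases hw : w = v
        · subst hw; simp [hv]
        · simp [hw, hb w hw]
      · right
        funext w
        by_cases hw : w = v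
        · subst hw; simp [hv]
        · simp [hw, hb w hw]
    · rintro (rfl | rfl) w hw <;> simp [hw]
  rw [sumOver, h, Finset.sum_pair]
  intro h
  simpa using congrFun h v

theorem sumOver_union {C D : Finset N} (hCD : Disjoint C D) (f : (N → Bool) → ℝ)
    (a : N → Bool) : sumOver (C ∪ D) f a = sumOver C (sumOver D f) a := by
  unfold sumOver
  -- Fibers of the map that keeps the values on `C` and resets all others to `a`.
  rw [← Finset.sum_fiberwise_of_maps_to (g := fun c v => if v ∈ C then c v else a v)
    (t := Finset.univ.filter fun b : N → Bool => ∀ v, v ∉ C → b v = a v)]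
  · refine Finset.sum_congr rfl fun b hb => Finset.sum_congr ?_ fun _ _ => rfl
    simp only [Finset.mem_filter, Finset.mem_univ, true_and] at hb
    ext c
    simp only [Finset.mem_union, not_or, Finset.mem_filter, Finset.mem_univ, true_and]
    constructor
    · rintro ⟨h1, rfl⟩ v hv
      by_cases hC : v ∈ C
      · simp [hC]
      · simp [hC, h1 v ⟨hC, hv⟩]
    · intro h
      refine ⟨fun v hv => by rw [h v hv.2, hb v hv.1], funext fun v => ?_⟩
      by_cases hC : v ∈ C
      · simp [hC, h v (Finset.disjoint_left.1 hCD hC)]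
      · simp [hC, hb v hC]
  · intro c _
    simp only [Finset.mem_filter, Finset.mem_univ, true_and]
    intro v hv
    simp [hv]

theorem DependsOn.sumOver {f : (N → Bool) → ℝ} {s : Set N} (hf : DependsOn f s)
    (C : Finset N) : DependsOn (sumOver C f) (s \ C) := by
  intro a b hab
  rw [sumOver_eq_sum, sumOver_eq_sum]
  refine Finset.sum_congr rfl fun c _ => hf fun v hv => ?_
  by_cases hC : v ∈ C
  · simp [hC]
  · simp [hC, hab v ⟨hv, hC⟩]

theorem sumOver_mul_left {C : Finset N} {f : (N → Bool) → ℝ} {s : Set N} (hf : DependsOn f s)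
    (hs : ∀ v ∈ C, v ∉ s) (g : (N → Bool) → ℝ) (a : N → Bool) :
    sumOver C (fun b => f b * g b) a = f a * sumOver C g a := by
  rw [sumOver, sumOver, Finset.mul_sum]
  refine Finset.sum_congr rfl fun b hb => ?_
  simp only [Finset.mem_filter, Finset.mem_univ, true_and] at hb
  rw [hf fun v hv => hb v fun h => hs v h hv]

theorem sumOver_div_right {C : Finset N} {f : (N → Bool) → ℝ} {s : Set N} (hf : DependsOn f s)
    (hs : ∀ v ∈ C, v ∉ s) (g : (N → Bool) → ℝ) (a : N → Bool) :
    sumOver C (fun b => g b / f b) a = sumOver C g a / f a := by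
  rw [sumOver, sumOver, Finset.sum_div]
  refine Finset.sum_congr rfl fun b hb => ?_
  simp only [Finset.mem_filter, Finset.mem_univ, true_and] at hb
  rw [hf fun v hv => hb v fun h => hs v h hv]

/-- The product of functions that depend on different summation variables. -/
theorem sumOver_union_mul {C D : Finset N} (hCD : Disjoint C D) {f g : (N → Bool) → ℝ}
    {s t : Set N} (hf : DependsOn f s) (hg : DependsOn g t) (hs : ∀ v ∈ D, v ∉ s)
    (ht : ∀ v ∈ C, v ∉ t) (a : N → Bool) :
    sumOver (C ∪ D) (fun b => f b * g b) a = sumOver C f a * sumOver D g a := by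
  rw [sumOver_union hCD, sumOver_congr fun b _ => sumOver_mul_left hf hs g b,
    sumOver_congr (fun b _ => mul_comm (f b) _),
    sumOver_mul_left (hg.sumOver D) (fun v hv h => ht v hv h.1), mul_comm]

/-- The marginal of `J` for the variables in `T`. -/
def marginal (J : (N → Bool) → ℝ) (T : Finset N) (a : N → Bool) : ℝ :=
  ∑ b : N → Bool with ∀ v ∈ T, b v = a v, J b

theorem marginal_eq_sumOver (J : (N → Bool) → ℝ) (T : Finset N) :
    marginal J T = sumOver Tᶜ J := by
  funext a
  simp [marginal, sumOver]

theorem marginal_congr {J : (N → Bool) → ℝ} {T : Finset N} {a b : N → Bool}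
    (h : ∀ v ∈ T, a v = b v) : marginal J T a = marginal J T b := by
  refine Finset.sum_congr (Finset.filter_congr fun c _ => ?_) fun _ _ => rfl
  simp +contextual only [h]

theorem dependsOn_marginal (J : (N → Bool) → ℝ) (T : Finset N) :
    DependsOn (marginal J T) (T : Set N) := fun _ _ h => marginal_congr h

theorem marginal_pos {J : (N → Bool) → ℝ} (hJ : ∀ a, 0 < J a) (T : Finset N) (a : N → Bool) :
    0 < marginal J T a :=
  Finset.sum_pos (fun b _ => hJ b) ⟨a, by simp⟩

theorem sumOver_marginal (J : (N → Bool) → ℝ) {T C : Finset N} (h : Disjoint T C)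
    (a : N → Bool) : sumOver C (marginal J (T ∪ C)) a = marginal J T a := by
  rw [marginal_eq_sumOver, marginal_eq_sumOver, ← sumOver_union]
  · congr 1
    ext v
    have h1 : v ∈ T → v ∉ C := fun hv => Finset.disjoint_left.1 h hv
    simp only [Finset.mem_union, Finset.mem_compl]
    tauto
  · rw [Finset.disjoint_left]
    intro v hv
    simp [hv]

/-- Conditional independence of `L` and `R` given `S`, at the values that the variables have
in `a`. -/
def CondIndep (J : (N → Bool) → ℝ) (L R S : Finset N) (a : N → Bool) : Prop :=
  marginal J (L ∪ R ∪ S) a * marginal J S a = marginal J (L ∪ S) a * marginal J (R ∪ S) a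

theorem CondIndep.symm {J : (N → Bool) → ℝ} {L R S : Finset N} {a : N → Bool}
    (h : CondIndep J L R S a) : CondIndep J R L S a := by
  unfold CondIndep at *
  rw [Finset.union_comm R L, h, mul_comm]

/-- The contraction property, followed by a decomposition. -/
theorem CondIndep.contraction {J : (N → Bool) → ℝ} (hJ : ∀ a, 0 < J a) {L R S C : Finset N}
    {a : N → Bool} (hL : Disjoint L C) (hR : Disjoint R C) (hS : Disjoint S C)
    (h : ∀ b, (∀ v, v ∉ C → b v = a v) → CondIndep J L R (S ∪ C) b)
    (h' : ∀ b, (∀ v, v ∉ C → b v = a v) → CondIndep J L C S b) : CondIndep J L R S a := by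
  -- Multiply the two independence identities and cancel $P(S,C)>0$. The left factor on each side
  -- does not involve `C`, so summing over `C` removes `C` from the right factors.
  have key : ∀ b, (∀ v, v ∉ C → b v = a v) →
      marginal J S b * marginal J (L ∪ R ∪ S ∪ C) b =
        marginal J (L ∪ S) b * marginal J (R ∪ S ∪ C) b := by
    intro b hb
    have h1 := h b hb
    have h2 := h' b hb
    unfold CondIndep at h1 h2
    rw [Finset.union_right_comm L C S] at h2
    rw [Finset.union_comm C S] at h2
    simp only [← Finset.union_assoc] at h1 h2
    have := (marginal_pos hJ (S ∪ C) b).ne'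
    apply mul_right_cancel₀ this
    linear_combination marginal J S b * h1 + marginal J (R ∪ S ∪ C) b * h2
  have hd : ∀ T : Finset N, Disjoint T C → ∀ v ∈ C, v ∉ (T : Set N) := fun T hT v hv h =>
    Finset.disjoint_left.1 hT h hv
  have hLS : Disjoint (L ∪ S) C := Finset.disjoint_union_left.2 ⟨hL, hS⟩
  have hRS : Disjoint (R ∪ S) C := Finset.disjoint_union_left.2 ⟨hR, hS⟩
  have hLRS : Disjoint (L ∪ R ∪ S) C :=
    Finset.disjoint_union_left.2 ⟨Finset.disjoint_union_left.2 ⟨hL, hR⟩, hS⟩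
  have := sumOver_congr key
  rw [sumOver_mul_left (dependsOn_marginal J S) (hd _ hS),
    sumOver_mul_left (dependsOn_marginal J _) (hd _ hLS),
    sumOver_marginal J hLRS, sumOver_marginal J hRS] at this
  unfold CondIndep
  rw [mul_comm, this]

/-- The intersection property, followed by a decomposition. -/
theorem CondIndep.intersection {J : (N → Bool) → ℝ} (hJ : ∀ a, 0 < J a) {L R S C : Finset N}
    {a : N → Bool} (hL : Disjoint L C) (hR : Disjoint R C) (hS : Disjoint S C)
    (h : ∀ b, (∀ v, v ∉ C → b v = a v) → CondIndep J L R (S ∪ C) b)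
    (h' : ∀ b, (∀ v, v ∉ C → b v = a v) → CondIndep J L C (S ∪ R) b) :
    CondIndep J L R S a := by
  -- The same device, but here the cancelled factor is $P(R,S,C)$.
  have key : ∀ b, (∀ v, v ∉ C → b v = a v) →
      marginal J (R ∪ S) b * marginal J (L ∪ S ∪ C) b =
        marginal J (L ∪ R ∪ S) b * marginal J (S ∪ C) b := by
    intro b hb
    have h1 := h b hb
    have h2 := h' b hb
    unfold CondIndep at h1 h2
    rw [Finset.union_right_comm L C, Finset.union_comm S R, Finset.union_comm C] at h2
    simp only [← Finset.union_assoc] at h1 h2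
    have := (marginal_pos hJ (R ∪ S ∪ C) b).ne'
    apply mul_right_cancel₀ this
    linear_combination marginal J (S ∪ C) b * h2 - marginal J (R ∪ S) b * h1
  have hd : ∀ T : Finset N, Disjoint T C → ∀ v ∈ C, v ∉ (T : Set N) := fun T hT v hv h =>
    Finset.disjoint_left.1 hT h hv
  have hLS : Disjoint (L ∪ S) C := Finset.disjoint_union_left.2 ⟨hL, hS⟩
  have hRS : Disjoint (R ∪ S) C := Finset.disjoint_union_left.2 ⟨hR, hS⟩
  have hLRS : Disjoint (L ∪ R ∪ S) C :=
    Finset.disjoint_union_left.2 ⟨Finset.disjoint_union_left.2 ⟨hL, hR⟩, hS⟩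
  have := sumOver_congr key
  rw [sumOver_mul_left (dependsOn_marginal J _) (hd _ hRS),
    sumOver_mul_left (dependsOn_marginal J _) (hd _ hLRS),
    sumOver_marginal J hLS, sumOver_marginal J hS] at this
  unfold CondIndep
  rw [← this, mul_comm]

end Marginals

open Relation

/-! ### Extending active walks inside an ancestral set. -/

section Connection

variable {N : Type*} {E : N → N → Prop} {L R S : Set N}

/-- `b` is in `L`, or an active walk leads from `L` to `b`. -/
def Connected (E : N → N → Prop) (L S : Set N) (b : N) : Prop :=
  b ∈ L ∨ ∃ y ∈ L, ∃ a, ActiveWalk E S y a b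

/-- The directed path from `b` to `d` is walked backwards from `d`. Its inner nodes are descendants
of `b`, hence outside `S`, and acyclicity prevents colliders. -/
theorem activeWalk_up (hE : ∀ v, ¬ TransGen E v v) {b d : N} (h : ReflTransGen E b d)
    (hS : ∀ x ∈ S, ¬ ReflTransGen E b x) : b = d ∨ ∃ a, E b a ∧ ActiveWalk E S d a b := by
  induction h using ReflTransGen.head_induction_on with
  | refl => exact .inl rfl
  | @head b c hbc _ ih =>
    right
    rcases ih fun x hx h => hS x hx (h.head hbc) with rfl | ⟨a, hca, hw⟩
    · exact ⟨c, hbc, .start (.inr hbc)⟩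
    · refine ⟨c, hbc, .nonCollider hw (.inr hbc) ?_ fun hc => hS c hc (.single hbc)⟩
      exact fun h => hE a ((TransGen.single h.1).tail hca)

theorem ActiveWalk.down (hE : ∀ v, ¬ TransGen E v v) {y a b d : N} (hw : ActiveWalk E S y a b)
    (h : ReflTransGen E b d) (hS : ∀ x ∈ S, ¬ ReflTransGen E b x) :
    ∃ a, ActiveWalk E S y a d := by
  induction h with
  | refl => exact ⟨a, hw⟩
  | @tail c d hbc hcd ih =>
    obtain ⟨a', h'⟩ := ih
    exact ⟨c, h'.nonCollider (.inl hcd) (fun h => hE c ((TransGen.single hcd).tail h.2))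
      fun hc => hS c hc hbc⟩

/-- The only difficult case is a collider `b` without descendants in `S`. By ancestrality it has a
descendant in `L` or `R`. In the first case the walk is restarted from that element of `L`, climbing
to `b`, which is then no collider; in the second the walk descends to `R` and contradicts the
separation. -/
theorem Connected.step (hE : ∀ v, ¬ TransGen E v v)
    (hsep : DSeparated E L R S) {b c : N} (h : Connected E L S b)
    (hanc : ∃ d, (d ∈ L ∨ d ∈ R ∨ d ∈ S) ∧ ReflTransGen E b d)
    (hb : b ∉ S) (hbc : E b c ∨ E c b) : Connected E L S c := by
  rcases h with hL | ⟨y, hy, a, hw⟩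
  · exact .inr ⟨b, hL, b, .start hbc⟩
  by_cases hcol : E a b ∧ E c b
  swap
  · exact .inr ⟨y, hy, b, hw.nonCollider hbc hcol hb⟩
  by_cases hS : ∃ x ∈ S, ReflTransGen E b x
  · exact .inr ⟨y, hy, b, hw.collider hcol.1 hcol.2 hS⟩
  replace hS : ∀ x ∈ S, ¬ ReflTransGen E b x := by simpa using hS
  obtain ⟨d, hd | hd | hd, hbd⟩ := hanc
  · rcases activeWalk_up hE hbd hS with rfl | ⟨a', ha', hw'⟩
    · exact .inr ⟨b, hd, b, .start hbc⟩
    · refine .inr ⟨d, hd, b, hw'.nonCollider hbc (fun h => ?_) hb⟩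
      exact hE b ((TransGen.single ha').tail h.1)
  · obtain ⟨a', h'⟩ := hw.down hE hbd hS
    exact (hsep y hy d hd a' h').elim
  · exact (hS d hd hbd).elim

/-- This is the moralizing edge between two parents of `v`: if `v` is in `S` it is an open collider,
otherwise two single steps through `v` suffice. -/
theorem Connected.coparent (hE : ∀ v, ¬ TransGen E v v)
    (hsep : DSeparated E L R S) {b c v : N} (h : Connected E L S b)
    (hanc : ∃ d, (d ∈ L ∨ d ∈ R ∨ d ∈ S) ∧ ReflTransGen E v d)
    (hb : b ∉ S) (hbv : E b v) (hcv : E c v) : Connected E L S c := by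
  have hancb : ∃ d, (d ∈ L ∨ d ∈ R ∨ d ∈ S) ∧ ReflTransGen E b d := by
    obtain ⟨d, hd, h⟩ := hanc
    exact ⟨d, hd, h.head hbv⟩
  by_cases hv : v ∈ S
  · rcases h with hL | ⟨y, hy, a, hw⟩
    · exact .inr ⟨b, hL, v, .collider (.start (.inl hbv)) hbv hcv ⟨v, hv, .refl⟩⟩
    · exact .inr ⟨y, hy, v, .collider (hw.nonCollider (.inl hbv)
        (fun h => hE b ((TransGen.single hbv).tail h.2)) hb) hbv hcv ⟨v, hv, .refl⟩⟩
  · exact (h.step hE hsep hancb hb (.inl hbv)).step hE hsep hanc hv (.inr hcv)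

end Connection

/-! ### Factorization over a DAG and the global Markov property. -/

section Markov

variable {N : Type*}

/-- The probability of the value `a v` of a binary variable that is `1` with probability `q`. -/
def bernoulliFactor (q : N → (N → Bool) → ℝ) (v : N) (a : N → Bool) : ℝ :=
  if a v then q v a else 1 - q v a

variable {E : N → N → Prop} {q : N → (N → Bool) → ℝ}

theorem dependsOn_bernoulliFactor
    (hq : ∀ v a b, (∀ u, E u v → a u = b u) → q v a = q v b) (v : N) :
    DependsOn (bernoulliFactor q v) {u | u = v ∨ E u v} := by
  intro a b h
  unfold bernoulliFactor
  rw [h v (.inl rfl), hq v a b fun u hu => h u (.inr hu)]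

theorem exists_minimal_of_acyclic [Finite N] (hE : ∀ v, ¬ TransGen E v v)
    {A : Finset N} (hA : A.Nonempty) :
    ∃ v ∈ A, ∀ u, E u v → u ∉ A := by
  have : IsTrans N (TransGen E) := ⟨fun _ _ _ => TransGen.trans⟩
  have : Std.Irrefl (TransGen E) := ⟨hE⟩
  obtain ⟨v, hv, h⟩ := (Finite.wellFounded_of_trans_of_irrefl (TransGen E)).has_min (A : Set N) hA
  exact ⟨v, hv, fun u hu hA => h u hA (.single hu)⟩

variable [Fintype N] [DecidableEq N]

/-- Variables outside of an ancestral set can be removed from a Bayesian network. -/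
theorem sumOver_compl_prod (hE : ∀ v, ¬ TransGen E v v)
    (hq : ∀ v a b, (∀ u, E u v → a u = b u) → q v a = q v b)
    (A : Finset N) (hA : ∀ u v, E u v → v ∈ A → u ∈ A) (a : N → Bool) :
    sumOver Aᶜ (fun b => ∏ v, bernoulliFactor q v b) a = ∏ v ∈ A, bernoulliFactor q v a := by
  induction h : Aᶜ.card using Nat.strong_induction_on generalizing A a with
  | _ k ih =>
  subst h
  rcases Finset.eq_empty_or_nonempty Aᶜ with h0 | hne
  · rw [h0, sumOver_empty, (Finset.compl_eq_empty_iff A).1 h0]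
  -- All parents of `v` lie in `A`, so adding `v` keeps the set ancestral. The induction hypothesis
  -- sums out everything else, and the factor of `v` then sums to $1$.
  obtain ⟨v, hv, hmin⟩ := exists_minimal_of_acyclic hE hne
  simp only [Finset.mem_compl, not_not] at hv hmin
  have hA' : ∀ u w, E u w → w ∈ insert v A → u ∈ insert v A := by
    intro u w huw hw
    rcases Finset.mem_insert.1 hw with rfl | hw
    · exact Finset.mem_insert_of_mem (hmin u huw)
    · exact Finset.mem_insert_of_mem (hA u w huw hw)
  have hcompl : Aᶜ = {v} ∪ (insert v A)ᶜ := by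
    ext w
    simp only [Finset.mem_compl, Finset.mem_union, Finset.mem_singleton, Finset.mem_insert]
    by_cases hw : w = v
    · subst hw; simp [hv]
    · simp [hw]
  have hcard : (insert v A)ᶜ.card < Aᶜ.card := by
    apply Finset.card_lt_card
    rw [Finset.compl_ssubset_compl]
    exact Finset.ssubset_insert hv
  rw [hcompl, sumOver_union (by simp), sumOver_congr fun b _ => ih _ hcard _ hA' b rfl,
    sumOver_singleton]
  have hfac : ∀ x, ∏ w ∈ A, bernoulliFactor q w (Function.update a v x) =
      ∏ w ∈ A, bernoulliFactor q w a := by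
    intro x
    refine Finset.prod_congr rfl fun w hw => dependsOn_bernoulliFactor hq w fun u hu => ?_
    have : u ∈ A := by
      rcases hu with rfl | hu
      · exact hw
      · exact hA u w hu hw
    exact Function.update_of_ne (ne_of_mem_of_not_mem this hv) _ _
  have hqv : ∀ x, q v (Function.update a v x) = q v a := by
    intro x
    refine hq v _ _ fun u hu => Function.update_of_ne ?_ _ _
    rintro rfl
    exact hE u (.single hu)
  rw [Finset.prod_insert hv, Finset.prod_insert hv, hfac, hfac, ← add_mul]
  simp [bernoulliFactor, hqv]

open scoped Classical in
/-- The global Markov property of Bayesian networks. -/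
theorem DSeparated.condIndep (hE : ∀ v, ¬ TransGen E v v)
    (hq : ∀ v a b, (∀ u, E u v → a u = b u) → q v a = q v b)
    {L R S : Finset N}
    (hsep : DSeparated E (L : Set N) R S)
    (hLR : Disjoint L R) (hLS : Disjoint L S) (a : N → Bool) :
    CondIndep (fun b => ∏ v, bernoulliFactor q v b) L R S a := by
  set J : (N → Bool) → ℝ := fun b => ∏ v, bernoulliFactor q v b with hJ
  -- The ancestors of `L`, `R` and `S`; all other variables sum out.
  let A : Finset N := {v | ∃ d, (d ∈ L ∨ d ∈ R ∨ d ∈ S) ∧ ReflTransGen E v d}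
  have memA : ∀ v, v ∈ A ↔ ∃ d, (d ∈ L ∨ d ∈ R ∨ d ∈ S) ∧ ReflTransGen E v d := by
    intro v; simp [A]
  have hA : ∀ u v, E u v → v ∈ A → u ∈ A := by
    intro u v huv hv
    rw [memA] at hv ⊢
    obtain ⟨d, hd, h⟩ := hv
    exact ⟨d, hd, h.head huv⟩
  have hLA : L ⊆ A := fun v hv => (memA v).2 ⟨v, .inl hv, .refl⟩
  have hRA : R ⊆ A := fun v hv => (memA v).2 ⟨v, .inr (.inl hv), .refl⟩
  have hSA : S ⊆ A := fun v hv => (memA v).2 ⟨v, .inr (.inr hv), .refl⟩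
  -- The part of `A` outside `S` that is d-connected to `L`. It contains `L` and avoids `R`.
  let U : Finset N := A.filter fun v => v ∉ S ∧ Connected E (L : Set N) S v
  have memU : ∀ v, v ∈ U ↔ v ∈ A ∧ v ∉ S ∧ Connected E (L : Set N) S v := by
    intro v; simp [U]
  have hLU : L ⊆ U := fun v hv =>
    (memU v).2 ⟨hLA hv, Finset.disjoint_left.1 hLS hv, .inl hv⟩
  have hRU : Disjoint R U := by
    rw [Finset.disjoint_left]
    intro v hv hvU
    rcases ((memU v).1 hvU).2.2 with h | ⟨y, hy, b, h⟩
    · exact Finset.disjoint_left.1 hLR h hv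
    · exact hsep y hy v hv b h
  have hSU : Disjoint S U := by
    rw [Finset.disjoint_left]
    exact fun v hv hvU => ((memU v).1 hvU).2.1 hv
  -- a family that meets `U` is contained in `U ∪ S`
  have hfam : ∀ v ∈ A, ∀ b c, (b = v ∨ E b v) → (c = v ∨ E c v) → b ∈ U → c ∈ U ∨ c ∈ S := by
    intro v hv b c hb hc hbU
    by_cases hcS : c ∈ S
    · exact .inr hcS
    have hcA : c ∈ A := by
      rcases hc with rfl | hc
      · exact hv
      · exact hA c v hc hv
    obtain ⟨hbA, hbS, hbC⟩ := (memU b).1 hbU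
    refine .inl ((memU c).2 ⟨hcA, hcS, ?_⟩)
    rcases hb with rfl | hb <;> rcases hc with rfl | hc
    · exact hbC
    · exact hbC.step hE hsep ((memA b).1 hbA) hbS (.inr hc)
    · exact hbC.step hE hsep ((memA b).1 hbA) hbS (.inl hb)
    · exact hbC.coparent hE hsep ((memA v).1 hv) hbS hb hc
  -- The families that meet `U`. Their factors `f` involve only `U` and `S`, and the remaining
  -- factors `g` do not involve `U`.
  let B : Finset N := A.filter fun v => ∃ b ∈ U, b = v ∨ E b v
  let f : (N → Bool) → ℝ := fun b => ∏ v ∈ B, bernoulliFactor q v b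
  let g : (N → Bool) → ℝ := fun b => ∏ v ∈ A \ B, bernoulliFactor q v b
  have hf : DependsOn f ((U : Set N) ∪ S) := by
    intro b c hbc
    refine Finset.prod_congr rfl fun v hv => dependsOn_bernoulliFactor hq v fun u hu => hbc u ?_
    obtain ⟨hvA, w, hwU, hw⟩ := Finset.mem_filter.1 hv
    exact hfam v hvA w u hw hu hwU
  have hg : DependsOn g ((U : Set N)ᶜ) := by
    intro b c hbc
    refine Finset.prod_congr rfl fun v hv => dependsOn_bernoulliFactor hq v fun u hu => hbc u ?_
    intro huU
    obtain ⟨hvA, hvB⟩ := Finset.mem_sdiff.1 hv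
    exact hvB (Finset.mem_filter.2 ⟨hvA, u, huU, hu⟩)
  -- Since `S` is fixed by `T`, the sum splits into a `U` part and a part off `U`. Adding `L` to `T`
  -- affects only the first and adding `R` only the second, which gives the product identity.
  have hmarg : ∀ T, S ⊆ T → T ⊆ A →
      marginal J T a = sumOver (U \ T) f a * sumOver ((A \ U) \ T) g a := by
    intro T hST hTA
    have h1 : Tᶜ = (A \ T) ∪ Aᶜ := by
      ext v
      have : v ∈ T → v ∈ A := fun h => hTA h
      simp only [Finset.mem_compl, Finset.mem_union, Finset.mem_sdiff]
      tauto
    have h2 : A \ T = (U \ T) ∪ ((A \ U) \ T) := by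
      ext v
      have : v ∈ U → v ∈ A := fun h => ((memU v).1 h).1
      simp only [Finset.mem_union, Finset.mem_sdiff]
      tauto
    rw [marginal_eq_sumOver, h1, sumOver_union, hJ,
      sumOver_congr fun b _ => sumOver_compl_prod hE hq A hA b, h2, ← sumOver_union_mul _ hf hg]
    · refine sumOver_congr fun b _ => ?_
      rw [mul_comm]
      exact (Finset.prod_sdiff (Finset.filter_subset _ _)).symm
    · intro v hv h
      simp only [Finset.mem_sdiff] at hv
      rcases h with h | h
      · exact hv.1.2 h
      · exact hv.2 (hST h)
    · intro v hv h
      exact h (Finset.mem_sdiff.1 hv).1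
    · rw [Finset.disjoint_left]
      intro v hv h
      simp only [Finset.mem_sdiff] at hv h
      exact h.1.2 hv.1
    · rw [Finset.disjoint_left]
      intro v hv h
      simp only [Finset.mem_sdiff, Finset.mem_compl] at hv h
      exact h hv.1
  unfold CondIndep
  rw [hmarg S subset_rfl hSA, hmarg (L ∪ S) Finset.subset_union_right
    (Finset.union_subset hLA hSA), hmarg (R ∪ S) Finset.subset_union_right
    (Finset.union_subset hRA hSA), hmarg (L ∪ R ∪ S) Finset.subset_union_right
    (Finset.union_subset (Finset.union_subset hLA hRA) hSA)]
  have e1 : U \ (L ∪ R ∪ S) = U \ (L ∪ S) := by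
    ext v
    have : v ∈ R → v ∉ U := fun h => Finset.disjoint_left.1 hRU h
    simp only [Finset.mem_union, Finset.mem_sdiff]
    tauto
  have e2 : U \ (R ∪ S) = U \ S := by
    ext v
    have : v ∈ R → v ∉ U := fun h => Finset.disjoint_left.1 hRU h
    simp only [Finset.mem_union, Finset.mem_sdiff]
    tauto
  have e3 : (A \ U) \ (L ∪ R ∪ S) = (A \ U) \ (R ∪ S) := by
    ext v
    have : v ∈ L → v ∈ U := fun h => hLU h
    simp only [Finset.mem_union, Finset.mem_sdiff]
    tauto
  have e4 : (A \ U) \ (L ∪ S) = (A \ U) \ S := by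
    ext v
    have : v ∈ L → v ∈ U := fun h => hLU h
    simp only [Finset.mem_union, Finset.mem_sdiff]
    tauto
  rw [e1, e2, e3, e4]
  ring

end Markov

/-! ### CSI statements and their truth in a distribution. -/

namespace CSI

variable {N : Type*} [DecidableEq N]

/-- The assignment agrees with the context. -/
def Agrees (w : N → Option Bool) (a : N → Bool) : Prop := ∀ v b, w v = some b → a v = b

theorem agrees_extendCtx {w : N → Option Bool} {a : N → Bool} (ha : Agrees w a)
    (C : Finset N) : Agrees (extendCtx w C fun v => a v.1) a := by
  intro v b hv
  by_cases hC : v ∈ C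
  · simpa [extendCtx, hC] using hv
  · exact ha v b (by simpa [extendCtx, hC] using hv)

variable [Fintype N]

/-- The variables of the conditioning set and of the context. -/
def given (s : CSI N) : Finset N := s.cond ∪ Finset.univ.filter fun v => (s.ctx v).isSome

/-- The sets of variables of the CSI statement are disjoint. -/
structure IsDisjoint (s : CSI N) : Prop where
  left_right : Disjoint s.left s.right
  left_given : Disjoint s.left s.given
  right_given : Disjoint s.right s.given

/-- The CSI statement is true in the distribution `J`. -/
def Holds (J : (N → Bool) → ℝ) (s : CSI N) : Prop :=
  ∀ a, Agrees s.ctx a → CondIndep J s.left s.right s.given a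

theorem mem_given {s : CSI N} {v : N} : v ∈ s.given ↔ v ∈ s.cond ∨ s.ctx v ≠ none := by
  simp [given, Option.isSome_iff_ne_none]

theorem Agrees.of_eqOn {s : CSI N} {C : Finset N} (hC : Disjoint s.given C) {a b : N → Bool}
    (ha : Agrees s.ctx a) (h : ∀ v, v ∉ C → b v = a v) : Agrees s.ctx b := by
  intro v x hv
  rw [h v, ha v x hv]
  exact Finset.disjoint_left.1 hC (mem_given.2 (.inr (by simp [hv])))

theorem given_extendCtx (s : CSI N) (C : Finset N) (c : {v // v ∈ C} → Bool) :
    ({ s with ctx := extendCtx s.ctx C c } : CSI N).given = s.given ∪ C := by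
  ext v
  rw [mem_given, Finset.mem_union, mem_given]
  by_cases hv : v ∈ C <;> simp [extendCtx, hv]

end CSI

/-! ### Soundness of the label test and of CSI-separation. -/

namespace LDAG

variable {N : Type*} {G : LDAG N}

theorem ctxEdge_acyclic (s : N → Option Bool) (v : N) : ¬ TransGen (G.ctxEdge s) v v :=
  fun h => G.acyclic v (TransGen.mono (r := G.ctxEdge s) (fun _ _ => And.left) _ _ h)

/-- The endpoints of an edge that is dropped in the context are separated by the other parents. -/
theorem dSeparated_parents {w : N → Option Bool} {u v : N} (huv : G.edge u v) {S : Set N}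
    (hS : ∀ x, x ∈ S ↔ G.edge x v ∧ x ≠ u) (hdrop : ¬ G.ctxEdge w u v) :
    DSeparated (G.ctxEdge w) {v} {u} S := by
  rintro y rfl z rfl
  -- Here `y` is the child of the dropped edge and `z` its parent. A walk from `y` either keeps
  -- descending or stops at once at a parent in `S`. A collider below `y` would need a descendant
  -- among the parents of `y`, giving a cycle.
  have key : ∀ a b, ActiveWalk (G.ctxEdge w) S y a b →
      (G.ctxEdge w a b ∧ TransGen G.edge y b) ∨ (G.ctxEdge w b a ∧ b ∈ S ∧ a = y) := by
    intro a b h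
    induction h with
    | @start b h =>
      rcases h with h | h
      · exact .inl ⟨h, .single h.1⟩
      · refine .inr ⟨h, (hS b).2 ⟨h.1, ?_⟩, rfl⟩
        rintro rfl
        exact hdrop h
    | @collider a b c _ hab hcb hd ih =>
      rcases ih with ⟨_, ih⟩ | ⟨ih, _⟩
      · obtain ⟨d, hd, hbd⟩ := hd
        have hbd : ReflTransGen G.edge b d := ReflTransGen.mono (r := G.ctxEdge w) (fun _ _ => And.left) _ _ hbd
        exact (G.acyclic y ((ih.trans_left hbd).tail ((hS d).1 hd).1)).elim
      · exact (ctxEdge_acyclic w a ((TransGen.single hab).tail ih)).elim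
    | @nonCollider a b c _ hbc hn hb ih =>
      rcases ih with ⟨h, ih⟩ | ⟨_, ih, _⟩
      · have hbc : G.ctxEdge w b c := hbc.resolve_right fun h' => hn ⟨h, h'⟩
        exact .inl ⟨hbc, ih.tail hbc.1⟩
      · exact (hb ih).elim
  intro a h
  rcases key a z h with ⟨_, h⟩ | ⟨_, h, _⟩
  · exact G.acyclic y (h.tail huv)
  · exact ((hS z).1 h).2 rfl

/-- The walk argument starts at the child of the edge, which may be on either side of the statement.
Conditional independence is symmetric, so either orientation is enough. -/
theorem InLabel.cSISeparated {s : CSI N} (h : G.InLabel s) :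
    G.CSISeparated s ∨ G.CSISeparated ⟨s.right, s.left, s.cond, s.ctx⟩ := by
  obtain ⟨u, v, huv, hlr, hx, hl⟩ := h
  have hsep := dSeparated_parents huv (S := {x | x ∈ s.cond ∨ s.ctx x ≠ none}) hx
    (w := s.ctx) fun h => h.2 hl
  rcases hlr with ⟨h1, h2⟩ | ⟨h1, h2⟩
  · exact .inl (by simpa [CSISeparated, h1, h2] using hsep)
  · exact .inr (by simpa [CSISeparated, h1, h2] using hsep)

theorem CausalModel.cpd_pos (M : G.CausalModel) (v : N) (a : N → Bool) : 0 < M.cpd v a := by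
  unfold CausalModel.cpd
  split
  · exact M.prob_pos v a
  · exact sub_pos.2 (M.prob_lt_one v a)

theorem CausalModel.joint_eq [Fintype N] (M : G.CausalModel) :
    M.joint = fun a => ∏ v, bernoulliFactor M.prob v a := rfl

theorem CausalModel.joint_pos [Fintype N] (M : G.CausalModel) (a : N → Bool) : 0 < M.joint a :=
  Finset.prod_pos fun v _ => M.cpd_pos v a

variable [Fintype N] [DecidableEq N] (M : G.CausalModel)

/-- In a context, a variable depends only on its parents in the context-specific DAG. -/
theorem CausalModel.prob_eq_of_ctxEdge {w : N → Option Bool} {v : N} {a b : N → Bool}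
    (ha : CSI.Agrees w a) (hb : CSI.Agrees w b) (h : ∀ u, G.ctxEdge w u v → a u = b u) :
    M.prob v a = M.prob v b := by
  -- The coordinates are changed from `a` to `b` one at a time. Every intermediate assignment agrees
  -- with the context, so at a dropped edge the label applies.
  have key : ∀ D : Finset N, M.prob v (fun u => if u ∈ D then b u else a u) = M.prob v a := by
    intro D
    induction D using Finset.induction_on with
    | empty => simp
    | @insert u D hu ih =>
      rw [← ih]
      have hoff : ∀ x, x ≠ u → (if x ∈ insert u D then b x else a x) =
          if x ∈ D then b x else a x := by
        intro x hx
        simp [hx]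
      by_cases hedge : G.edge u v
      · by_cases hctx : G.ctxEdge w u v
        · congr 1
          funext x
          by_cases hx : x = u
          · subst hx; simp [h x hctx]
          · exact hoff x hx
        · refine M.prob_label u v hedge _ _ hoff ?_
          have : ∀ l : {w : N // G.edge w v ∧ w ≠ u} → Bool,
              (∀ x b, w x.1 = some b → l x = b) → l ∈ G.label u v := by
            by_contra hl
            exact hctx ⟨hedge, hl⟩
          refine this _ fun x c hx => ?_
          split
          · exact hb x.1 c hx
          · exact ha x.1 c hx
      · refine M.prob_parents v _ _ fun x hx => hoff x ?_
        rintro rfl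
        exact hedge hx
  simpa using (key Finset.univ).symm

/-- The CSI-separation criterion is sound. -/
theorem CSISeparated.holds {s : CSI N} (h : G.CSISeparated s) (hs : s.IsDisjoint) :
    s.Holds M.joint := by
  intro a ha
  -- Overwriting the context variables makes the conditional probabilities depend only on parents in
  -- the context-specific DAG for every assignment, not just for those that agree with the context.
  let fix : (N → Bool) → N → Bool := fun b v => (s.ctx v).getD (b v)
  have hfix : ∀ b, CSI.Agrees s.ctx (fix b) := fun b v x hv => by simp [fix, hv]
  have hfix' : ∀ b, CSI.Agrees s.ctx b → fix b = b := by
    intro b hb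
    funext v
    cases hv : s.ctx v with
    | none => simp [fix, hv]
    | some x => simp [fix, hv, hb v x hv]
  let q : N → (N → Bool) → ℝ := fun v b => M.prob v (fix b)
  have hq : ∀ v b c, (∀ u, G.ctxEdge s.ctx u v → b u = c u) → q v b = q v c := by
    intro v b c hbc
    refine M.prob_eq_of_ctxEdge (hfix b) (hfix c) fun u hu => ?_
    simp only [fix, hbc u hu]
  have hS : {x | x ∈ s.cond ∨ s.ctx x ≠ none} = (s.given : Set N) := by
    ext x
    exact CSI.mem_given.symm
  unfold CSISeparated at h
  rw [hS] at h
  have hci := h.condIndep (ctxEdge_acyclic s.ctx) hq hs.left_right hs.left_given a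
  -- Each `T` that occurs fixes the context variables, so only assignments that agree with the
  -- context contribute, and there `fix` changes nothing.
  have hmarg : ∀ T, s.given ⊆ T →
      marginal (fun b => ∏ v, bernoulliFactor q v b) T a = marginal M.joint T a := by
    intro T hT
    refine Finset.sum_congr rfl fun b hb => ?_
    simp only [Finset.mem_filter, Finset.mem_univ, true_and] at hb
    have hagree : CSI.Agrees s.ctx b := by
      intro v x hv
      rw [hb v (hT (CSI.mem_given.2 (.inr (by simp [hv])))), ha v x hv]
    simp only [M.joint_eq, bernoulliFactor, q, hfix' b hagree]
  unfold CondIndep at hci ⊢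
  rwa [hmarg _ subset_rfl, hmarg _ Finset.subset_union_right,
    hmarg _ Finset.subset_union_right, hmarg _ Finset.subset_union_right] at hci

theorem InLabel.holds {s : CSI N} (h : G.InLabel s) (hs : s.IsDisjoint) : s.Holds M.joint := by
  rcases h.cSISeparated with h | h
  · exact h.holds M hs
  · intro a ha
    exact (CSISeparated.holds M h ⟨hs.left_right.symm, hs.right_given, hs.left_given⟩ a ha).symm

end LDAG

/-! ### Soundness and termination of the recursive CSI test. -/

section Test

theorem List.exists_of_anyM_eq_some_true {α : Type*} {f : α → Option Bool} {l : List α}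
    (h : l.anyM f = some true) : ∃ x ∈ l, f x = some true := by
  induction l with
  | nil => simp [List.anyM] at h
  | cons x l ih =>
    rw [List.anyM] at h
    rcases hx : f x with _ | _ | _
    · simp [hx] at h
    · obtain ⟨y, hy, h'⟩ := ih (by simpa [hx] using h)
      exact ⟨y, List.mem_cons_of_mem _ hy, h'⟩
    · exact ⟨x, List.mem_cons_self, hx⟩

/-- The bound `k` is common to all entries, so from `k` on no entry is unfinished and the outcomes
no longer change. -/
theorem List.anyM_eventually {α : Type*} {f : ℕ → α → Option Bool} {l : List α} {k : ℕ}
    (h : ∀ x ∈ l, ∃ b, ∀ n ≥ k, f n x = some b) : ∃ b, ∀ n ≥ k, l.anyM (f n) = some b := by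
  induction l with
  | nil => exact ⟨false, fun n _ => rfl⟩
  | cons x l ih =>
    obtain ⟨b, hb⟩ := h x List.mem_cons_self
    obtain ⟨b', hb'⟩ := ih fun y hy => h y (List.mem_cons_of_mem _ hy)
    cases b with
    | true => exact ⟨true, fun n hn => by simp [List.anyM, hb n hn]⟩
    | false => exact ⟨b', fun n hn => by simp [List.anyM, hb n hn, hb' n hn]⟩

variable {N : Type*} [Fintype N] [DecidableEq N] {G : LDAG N}

/-- If a CSI statement is separated in every context that extends its own by one of the
representatives, then it holds if the chosen variables are added to the conditioning set. -/
theorem condIndep_of_representatives (σ : Strategy G) (M : G.CausalModel) {s : CSI N}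
    (hs : s.IsDisjoint) {C : Finset N} (hL : Disjoint s.left C) (hR : Disjoint s.right C)
    (h : ∀ q, G.CSISeparated { s with ctx := extendCtx s.ctx C (σ.rep s.ctx C q) })
    {a : N → Bool} (ha : CSI.Agrees s.ctx a) :
    CondIndep M.joint s.left s.right (s.given ∪ C) a := by
  let c : {v // v ∈ C} → Bool := fun v => a v.1
  have hrep : G.ctxEdge (extendCtx s.ctx C (σ.rep s.ctx C (Quotient.mk _ c))) =
      G.ctxEdge (extendCtx s.ctx C c) := by
    have := Quotient.exact (σ.mk_rep s.ctx C (Quotient.mk _ c))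
    exact this
  -- Separation depends on the context only through the context-specific DAG and the set of assigned
  -- nodes, so it passes from the representative to the actual values `c`.
  have hsep : G.CSISeparated { s with ctx := extendCtx s.ctx C c } := by
    have := h (Quotient.mk _ c)
    unfold LDAG.CSISeparated at this ⊢
    convert this using 1
    · exact hrep.symm
    · ext x
      by_cases hx : x ∈ C <;> simp [extendCtx, hx]
  have hdis : ({ s with ctx := extendCtx s.ctx C c } : CSI N).IsDisjoint := by
    constructor
    · exact hs.left_right
    · rw [CSI.given_extendCtx]
      exact Finset.disjoint_union_right.2 ⟨hs.left_given, hL⟩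
    · rw [CSI.given_extendCtx]
      exact Finset.disjoint_union_right.2 ⟨hs.right_given, hR⟩
  have := hsep.holds M hdis a (CSI.agrees_extendCtx ha C)
  rwa [CSI.given_extendCtx] at this

theorem CSI.given_union (s : CSI N) (L R D : Finset N) :
    (⟨L, R, s.cond ∪ D, s.ctx⟩ : CSI N).given = s.given ∪ D := by
  simp only [CSI.given]
  exact Finset.union_right_comm _ _ _

/-- The recursive test of CSI statements is sound. -/
theorem testCSI_sound (σ : Strategy G) (M : G.CausalModel) (n : ℕ) (used : Finset N) (s : CSI N)
    (hs : s.IsDisjoint) (h : testCSI σ n used s = some true) : s.Holds M.joint := by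
  induction n generalizing used s with
  | zero => simp [testCSI] at h
  | succ n ih =>
    rw [testCSI] at h
    split at h
    · rename_i h0
      exact h0.elim (fun h => h.holds M hs) fun h => h.holds M hs
    obtain ⟨C, hC, h⟩ := List.exists_of_anyM_eq_some_true h
    simp only [Finset.mem_toList, Finset.mem_filter, Finset.mem_univ, true_and] at hC
    obtain ⟨-, -, hL, hR, hc, hw⟩ := hC
    replace hL := hL.symm
    replace hR := hR.symm
    have hg : Disjoint s.given C := by
      rw [Finset.disjoint_left]
      intro v hv hvC
      rcases CSI.mem_given.1 hv with hv | hv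
      · exact Finset.disjoint_left.1 hc hvC hv
      · exact hv (hw v hvC)
    split at h
    swap
    · simp at h
    rename_i hrep
    have hind := fun {a} => condIndep_of_representatives σ M hs hL hR hrep (a := a)
    obtain ⟨s', hs', h⟩ := List.exists_of_anyM_eq_some_true h
    intro a ha
    have hind' : ∀ b, (∀ v, v ∉ C → b v = a v) →
        CondIndep M.joint s.left s.right (s.given ∪ C) b := fun b hb => hind (ha.of_eqOn hg hb)
    simp only [List.mem_cons, List.not_mem_nil, or_false] at hs'
    -- The statements without the opposite side in the condition enter through contraction, the
    -- other two through intersection. When `C` is separated from the right side, the roles of the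
    -- two sides are exchanged.
    rcases hs' with rfl | rfl | rfl | rfl
    · have := ih _ ⟨s.left, C, s.cond, s.ctx⟩ ⟨hL, hs.left_given, hg.symm⟩ h
      exact CondIndep.contraction M.joint_pos hL hR hg hind'
        fun b hb => this b (ha.of_eqOn hg hb)
    · have := ih _ ⟨C, s.right, s.cond, s.ctx⟩ ⟨hR.symm, hg.symm, hs.right_given⟩ h
      exact (CondIndep.contraction M.joint_pos hR hL hg (fun b hb => (hind' b hb).symm)
        fun b hb => (this b (ha.of_eqOn hg hb)).symm).symm
    · have := ih _ _ ⟨hL, by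
        rw [CSI.given_union]; exact Finset.disjoint_union_right.2 ⟨hs.left_given, hs.left_right⟩,
        by rw [CSI.given_union]; exact Finset.disjoint_union_right.2 ⟨hg.symm, hR.symm⟩⟩ h
      refine CondIndep.intersection M.joint_pos hL hR hg hind' fun b hb => ?_
      have := this b (ha.of_eqOn hg hb)
      rwa [CSI.given_union] at this
    · have := ih _ _ ⟨hR, by
        rw [CSI.given_union]
        exact Finset.disjoint_union_right.2 ⟨hs.right_given, hs.left_right.symm⟩,
        by rw [CSI.given_union]; exact Finset.disjoint_union_right.2 ⟨hg.symm, hL.symm⟩⟩ h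
      refine (CondIndep.intersection M.joint_pos hR hL hg (fun b hb => (hind' b hb).symm)
        fun b hb => ?_).symm
      have := this b (ha.of_eqOn hg hb)
      rwa [CSI.given_union] at this

/-- The recursive test of CSI statements terminates. -/
theorem testCSI_eventually (σ : Strategy G) (used : Finset N) (s : CSI N) :
    ∃ b, ∀ n ≥ usedᶜ.card + 1, testCSI σ n used s = some b := by
  induction h : usedᶜ.card using Nat.strong_induction_on generalizing used s with
  | _ k ih =>
  subst h
  suffices ∃ b, ∀ n ≥ usedᶜ.card, testCSI σ (n + 1) used s = some b by
    obtain ⟨b, hb⟩ := this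
    refine ⟨b, fun n hn => ?_⟩
    -- Depth `0` is always unfinished, hence the `+ 1` in the bound.
    obtain ⟨m, rfl⟩ : ∃ m, n = m + 1 := ⟨n - 1, by omega⟩
    exact hb m (by omega)
  by_cases h0 : G.InLabel s ∨ G.CSISeparated s
  · exact ⟨true, fun n _ => by rw [testCSI, if_pos h0]⟩
  simp only [testCSI, if_neg h0]
  refine List.anyM_eventually fun C hC => ?_
  simp only [Finset.mem_toList, Finset.mem_filter, Finset.mem_univ, true_and] at hC
  obtain ⟨hne, hdis, -⟩ := hC
  split
  swap
  · exact ⟨false, fun _ _ => rfl⟩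
  refine List.anyM_eventually fun s' _ => ?_
  -- `C` is nonempty and fresh, so the supply of unused nodes strictly shrinks.
  have hcard : (used ∪ C)ᶜ.card < usedᶜ.card := by
    apply Finset.card_lt_card
    rw [Finset.compl_ssubset_compl]
    refine Finset.ssubset_iff_subset_ne.2 ⟨Finset.subset_union_left, fun h => ?_⟩
    obtain ⟨v, hv⟩ := hne
    exact Finset.disjoint_left.1 hdis hv (h ▸ Finset.mem_union_right _ hv)
  obtain ⟨b, hb⟩ := ih _ hcard (used ∪ C) s' rfl
  exact ⟨b, fun n hn => hb n (by omega)⟩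

end Test

/-! ### Values of terms, and the rules as identities between values. -/

namespace Term

variable {N : Type*}

/-- The values of the variables of a term, where the variables for which the term is for all
values have the values that they have in `a`. -/
def assign (t : Term N) (a : N → Bool) (v : N) : Bool :=
  match t v with
  | .absent => a v
  | .left o => o.getD (a v)
  | .right o => o.getD (a v)

theorem assign_update [DecidableEq N] (t : Term N) (v : N) (r : Role) (a : N → Bool) (w : N) (hw : w ≠ v) :
    assign (Function.update t v r) a w = t.assign a w := by
  simp [assign, hw]

variable [Fintype N]

def leftVars (t : Term N) : Finset N := Finset.univ.filter fun v => ∃ o, t v = .left o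

def rightVars (t : Term N) : Finset N := Finset.univ.filter fun v => ∃ o, t v = .right o

@[simp] theorem mem_leftVars {t : Term N} {v : N} : v ∈ t.leftVars ↔ ∃ o, t v = .left o := by
  simp [leftVars]

@[simp] theorem mem_rightVars {t : Term N} {v : N} : v ∈ t.rightVars ↔ ∃ o, t v = .right o := by
  simp [rightVars]

theorem disjoint_leftVars_rightVars (t : Term N) : Disjoint t.leftVars t.rightVars := by
  rw [Finset.disjoint_left]
  intro v h h'
  obtain ⟨o, h⟩ := mem_leftVars.1 h
  obtain ⟨o', h'⟩ := mem_rightVars.1 h'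
  simp [h] at h'

variable [DecidableEq N]

/-- The value of a term in the joint distribution `J`. -/
noncomputable def value (J : (N → Bool) → ℝ) (t : Term N) (a : N → Bool) : ℝ :=
  marginal J (t.leftVars ∪ t.rightVars) (t.assign a) / marginal J t.rightVars (t.assign a)

/-- Lets terms with different fixed values or different nodes be evaluated at comparable
assignments. -/
theorem value_eq_of_eqOn {J : (N → Bool) → ℝ} {t : Term N} {a x : N → Bool}
    (hx : ∀ v, t v ≠ .absent → x v = t.assign a v) :
    t.value J a = marginal J (t.leftVars ∪ t.rightVars) x / marginal J t.rightVars x := by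
  rw [value, marginal_congr (b := x), marginal_congr (T := t.rightVars) (b := x)]
  · intro v hv
    obtain ⟨o, h⟩ := mem_rightVars.1 hv
    exact (hx v (by simp [h])).symm
  · intro v hv
    refine (hx v ?_).symm
    rcases Finset.mem_union.1 hv with h | h
    · obtain ⟨o, h⟩ := mem_leftVars.1 h
      simp [h]
    · obtain ⟨o, h⟩ := mem_rightVars.1 h
      simp [h]

theorem value_congr {J : (N → Bool) → ℝ} {t u : Term N} {a b : N → Bool}
    (hl : t.leftVars = u.leftVars) (hr : t.rightVars = u.rightVars)
    (h : t.assign a = u.assign b) : t.value J a = u.value J b := by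
  simp only [value, hl, hr, h]

/-- Accounts for the constant $1$ in rule 5 when nothing else is on the left. -/
theorem value_eq_one {J : (N → Bool) → ℝ} (hJ : ∀ a, 0 < J a) {t : Term N}
    (ht : ∀ v o, t v ≠ .left o) (a : N → Bool) : t.value J a = 1 := by
  have : t.leftVars = ∅ := by
    ext v
    simp [ht]
  rw [value, this, Finset.empty_union, div_self (marginal_pos hJ _ _).ne']

/-- The common core of rules 2 and 3: the denominator contains no summed variable, so the sum acts
on the numerator alone. -/
theorem sumOver_value (J : (N → Bool) → ℝ) {t : Term N} {S : Finset N}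
    (hS : ∀ v ∈ S, t v = .left none) (a : N → Bool) :
    sumOver S (t.value J) a =
      marginal J ((t.leftVars ∪ t.rightVars) \ S) (t.assign a) /
        marginal J t.rightVars (t.assign a) := by
  have hassign : ∀ F : (N → Bool) → ℝ,
      sumOver S (fun b => F (t.assign b)) a = sumOver S F (t.assign a) := by
    intro F
    rw [sumOver_eq_sum, sumOver_eq_sum]
    refine Finset.sum_congr rfl fun c _ => congrArg F (funext fun v => ?_)
    by_cases hv : v ∈ S
    · simp [assign, hS v hv, hv]
    · simp [assign, hv]
  have hsub : S ⊆ t.leftVars ∪ t.rightVars := fun v hv =>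
    Finset.mem_union_left _ (mem_leftVars.2 ⟨none, hS v hv⟩)
  have := sumOver_marginal J (Finset.sdiff_disjoint (s := S) (t := t.leftVars ∪ t.rightVars))
    (t.assign a)
  rw [Finset.sdiff_union_of_subset hsub] at this
  rw [← this, ← sumOver_div_right (dependsOn_marginal J t.rightVars)]
  · exact hassign fun x => marginal J (t.leftVars ∪ t.rightVars) x / marginal J t.rightVars x
  · intro v hv h
    obtain ⟨o, h⟩ := mem_rightVars.1 h
    simp [hS v hv] at h

theorem Rule1.csi_isDisjoint {long short : Term N} (h : Rule1 long short) :
    (rule1CSI long short).IsDisjoint := by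
  have hg : (rule1CSI long short).given ⊆ short.rightVars := by
    intro v hv
    rcases CSI.mem_given.1 hv with hv | hv
    · simp only [rule1CSI, Finset.mem_filter, Finset.mem_univ, true_and] at hv
      exact mem_rightVars.2 ⟨none, hv⟩
    · rcases hs : short v with _ | o | o
      · simp [rule1CSI, hs] at hv
      · simp [rule1CSI, hs] at hv
      · exact mem_rightVars.2 ⟨o, hs⟩
  have hl : (rule1CSI long short).left = short.leftVars := by
    ext v; simp [rule1CSI]
  have hr : ∀ v ∈ (rule1CSI long short).right, short v = .absent := by
    intro v hv
    simp only [rule1CSI, Finset.mem_filter, Finset.mem_univ, true_and] at hv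
    exact ((h v).resolve_left hv).1
  refine ⟨?_, ?_, ?_⟩
  · rw [hl, Finset.disjoint_left]
    intro v hv hv'
    simp [hr v hv'] at hv
  · rw [hl]
    exact short.disjoint_leftVars_rightVars.mono_right hg
  · rw [Finset.disjoint_left]
    intro v hv hv'
    have := hg hv'
    simp [hr v hv] at this

/-- The independence identity, divided by the two positive marginals of the conditioning sets. It is
used at `long.assign a`, which has the fixed values that the context requires. -/
theorem Rule1.value_eq {J : (N → Bool) → ℝ} (hJ : ∀ a, 0 < J a) {long short : Term N}
    (h : Rule1 long short) (hcsi : (rule1CSI long short).Holds J) (a : N → Bool) :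
    long.value J a = short.value J a := by
  have hg : (rule1CSI long short).given = short.rightVars := by
    ext v
    rw [CSI.mem_given, mem_rightVars]
    rcases hs : short v with _ | o | o <;> [skip; skip; cases o] <;> simp [rule1CSI, hs]
  have hl : (rule1CSI long short).left = short.leftVars := by
    ext v; simp [rule1CSI]
  have hll : long.leftVars = short.leftVars := by
    ext v
    rcases h v with h | ⟨h, o, h'⟩
    · simp [h]
    · simp [h, h']
  have hlr : long.rightVars = (rule1CSI long short).right ∪ short.rightVars := by
    ext v
    rw [Finset.mem_union]
    rcases h v with h | ⟨h, o, h'⟩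
    · simp [h, rule1CSI]
    · simp [h, h', rule1CSI]
  have hagree : CSI.Agrees (rule1CSI long short).ctx (long.assign a) := by
    intro v b hv
    rcases hs : short v with _ | o | o
    · simp [rule1CSI, hs] at hv
    · simp [rule1CSI, hs] at hv
    · rcases h v with h | ⟨h, -⟩
      · cases o with
        | none => simp [rule1CSI, hs] at hv
        | some x =>
          have : x = b := by simpa [rule1CSI, hs] using hv
          simp [assign, h, hs, this]
      · simp [h] at hs
  have hci := hcsi _ hagree
  rw [CondIndep, hg, hl, Finset.union_assoc, ← hlr] at hci
  have hshort : ∀ v, short v ≠ .absent → long.assign a v = short.assign a v := by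
    intro v hv
    rcases h v with h | ⟨h, -⟩
    · simp [assign, h]
    · exact (hv h).elim
  rw [value_eq_of_eqOn hshort, value, hll, div_eq_div_iff (marginal_pos hJ _ _).ne'
    (marginal_pos hJ _ _).ne', hci]

theorem Rule2.value_eq (J : (N → Bool) → ℝ) {concl prem : Term N} (h : Rule2 concl prem)
    {S : Finset N} (hS : ∀ v, v ∈ S ↔ prem v ≠ concl v) (a : N → Bool) :
    concl.value J a = sumOver S (prem.value J) a := by
  rw [sumOver_value J fun v hv => (((h v).resolve_left fun h => (hS v).1 hv h.symm)).1, value]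
  have h1 : concl.assign a = prem.assign a := by
    funext v
    rcases h v with h | ⟨h, h'⟩
    · simp [assign, h]
    · simp [assign, h, h']
  have h2 : concl.rightVars = prem.rightVars := by
    ext v
    rcases h v with h | ⟨h, h'⟩
    · simp [h]
    · simp [h, h']
  have h3 : concl.leftVars ∪ concl.rightVars = (prem.leftVars ∪ prem.rightVars) \ S := by
    ext v
    simp only [Finset.mem_union, Finset.mem_sdiff, hS]
    rcases h v with h | ⟨h, h'⟩
    · simp [h]
    · simp [h, h']
  rw [h1, h3, h2]

/-- The conclusion has no fixed value on the left, so the summed variables are exactly its left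
variables; the common denominator of the premise cancels. -/
theorem Rule3.value_eq {J : (N → Bool) → ℝ} (hJ : ∀ a, 0 < J a) {concl prem : Term N}
    (h : Rule3 concl prem) {S : Finset N} (hS : ∀ v, v ∈ S ↔ concl v = .left none)
    (a : N → Bool) :
    concl.value J a = prem.value J a / sumOver S (prem.value J) a := by
  rw [sumOver_value J, value, value]
  · have h1 : concl.assign a = prem.assign a := by
      funext v
      rcases h.1 v with h | ⟨o, h, h'⟩
      · simp [assign, h]
      · simp [assign, h, h']
    have h2 : concl.leftVars ∪ concl.rightVars = prem.leftVars ∪ prem.rightVars := by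
      ext v
      simp only [Finset.mem_union]
      rcases h.1 v with h | ⟨o, h, h'⟩
      · simp [h]
      · simp [h, h']
    have h3 : concl.rightVars = (prem.leftVars ∪ prem.rightVars) \ S := by
      rw [← h2]
      ext v
      simp only [Finset.mem_union, Finset.mem_sdiff, hS]
      have := h.2 v
      rcases hc : concl v with _ | o | o
      · simp [hc]
      · cases o with
        | none => simp [hc]
        | some b => exact (this b hc).elim
      · simp [hc]
    rw [div_div_div_cancel_right₀ (marginal_pos hJ _ _).ne', h1, h2, ← h3]
  · intro v hv
    have hc := (hS v).1 hv
    rcases h.1 v with h | ⟨o, _, h'⟩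
    · rw [← h, hc]
    · simp [hc] at h'

/-- The chain rule: the denominator of `fst` is the numerator of `snd`. -/
theorem Rule4.value_eq {J : (N → Bool) → ℝ} (hJ : ∀ a, 0 < J a) {concl fst snd : Term N}
    (h : Rule4 concl fst snd) (a : N → Bool) :
    concl.value J a = fst.value J a * snd.value J a := by
  have h1 : ∀ v, fst v ≠ .absent → concl.assign a v = fst.assign a v := by
    intro v _
    rcases h v with ⟨o, h1, h2, h3⟩ | ⟨o, h1, h2, h3⟩ | ⟨-, h2, h3⟩
    · simp [assign, h1, h2]
    · simp [assign, h1, h2]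
    · simp [assign, h2]
  have h2 : ∀ v, snd v ≠ .absent → concl.assign a v = snd.assign a v := by
    intro v hv
    rcases h v with ⟨o, h1, h2, h3⟩ | ⟨o, h1, h2, h3⟩ | ⟨-, h2, h3⟩
    · exact (hv h3).elim
    · simp [assign, h1, h3]
    · simp [assign, h3]
  have h3 : concl.leftVars ∪ concl.rightVars = fst.leftVars ∪ fst.rightVars := by
    ext v
    simp only [Finset.mem_union, mem_leftVars, mem_rightVars]
    rcases h v with ⟨o, h1, h2, h3⟩ | ⟨o, h1, h2, h3⟩ | ⟨-, h2, h3⟩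
    · simp [h1, h2]
    · simp [h1, h2]
    · simp [h2]
  have h4 : fst.rightVars = snd.leftVars ∪ snd.rightVars := by
    ext v
    simp only [Finset.mem_union, mem_leftVars, mem_rightVars]
    rcases h v with ⟨o, h1, h2, h3⟩ | ⟨o, h1, h2, h3⟩ | ⟨h1, h2, h3⟩
    · simp [h2, h3]
    · simp [h2, h3]
    · simp [h1, h2, h3]
  have h5 : concl.rightVars = snd.rightVars := by
    ext v
    simp only [mem_rightVars]
    rcases h v with ⟨o, h1, h2, h3⟩ | ⟨o, h1, h2, h3⟩ | ⟨h1, h2, h3⟩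
    · simp [h1, h3]
    · simp [h1, h3]
    · simp [h3]
  rw [value_eq_of_eqOn h1, value_eq_of_eqOn h2, value, h3, h4, h5,
    div_mul_div_cancel₀ (marginal_pos hJ _ _).ne']

theorem leftVars_update {t : Term N} {v : N} {o : Option Bool} (h : t v = .left o)
    (o' : Option Bool) : leftVars (Function.update t v (.left o')) = t.leftVars := by
  ext w
  by_cases hw : w = v
  · subst hw; simp [h]
  · simp [hw]

theorem rightVars_update {t : Term N} {v : N} {r : Role} (h : ∀ o, t v ≠ .right o)
    (hr : ∀ o, r ≠ .right o) : rightVars (Function.update t v r) = t.rightVars := by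
  ext w
  by_cases hw : w = v
  · subst hw; simp [h, hr]
  · simp [hw]

theorem Rule5.value_eq (J : (N → Bool) → ℝ) {v : N} {z : Bool} {concl all case : Term N}
    (h : Rule5 v z concl all case) (a : N → Bool) :
    concl.value J a = all.value J a - case.value J a := by
  obtain ⟨hv, rfl, rfl⟩ := h
  set all : Term N := Function.update case v Role.absent with hall
  have hx : ∀ y, ∀ w, w ≠ v → Function.update (all.assign a) v y w = case.assign a w := by
    intro y w hw
    rw [Function.update_of_ne hw, hall, assign_update _ _ _ _ _ hw]
  -- Both cases are evaluated at `all.assign a` with only `v` overwritten, so their numerators are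
  -- the two summands of the numerator of `all`, and the denominators agree.
  have h1 : case.value J a = _ := value_eq_of_eqOn (x := Function.update (all.assign a) v z) (by
    intro w _
    by_cases hw : w = v
    · subst hw; simp [assign, hv]
    · exact hx z w hw)
  have h2 : Term.value J (Function.update case v (.left (some !z))) a = _ :=
    value_eq_of_eqOn (x := Function.update (all.assign a) v !z) (by
    intro w _
    by_cases hw : w = v
    · subst hw; simp [assign]
    · rw [hx _ w hw, assign_update _ _ _ _ _ hw])
  have hr : all.rightVars = case.rightVars := rightVars_update (by simp [hv]) (by simp)
  have hl : case.leftVars ∪ case.rightVars = all.leftVars ∪ all.rightVars ∪ {v} := by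
    rw [hr]
    ext w
    by_cases hw : w = v
    · subst hw; simp [hv]
    · simp [hall, hw]
  have hd : Disjoint (all.leftVars ∪ all.rightVars) {v} := by
    rw [Finset.disjoint_singleton_right]
    simp [hall]
  have hsum := sumOver_marginal J hd (all.assign a)
  have hR : ∀ y, marginal J case.rightVars (Function.update (all.assign a) v y) =
      marginal J case.rightVars (all.assign a) := by
    intro y
    refine marginal_congr fun w hw => Function.update_of_ne ?_ _ _
    rintro rfl
    simp [hv] at hw
  rw [h1, h2, leftVars_update hv, rightVars_update (by simp [hv]) (by simp), hl, value, hr, hR,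
    hR, ← hr, ← hsum, sumOver_singleton]
  cases z <;> simp only [Bool.not_true, Bool.not_false] <;> ring

theorem Rule6.value_eq (J : (N → Bool) → ℝ) {v : N} {concl case0 case1 : Term N}
    (h : Rule6 v concl case0 case1) (a : N → Bool) :
    concl.value J a = if a v = false then case0.value J a else case1.value J a := by
  obtain ⟨hv, rfl, rfl⟩ := h
  have key : ∀ z, a v = z →
      concl.value J a = Term.value J (Function.update concl v (.left (some z))) a := by
    intro z hz
    refine value_congr (leftVars_update hv _).symm
      (rightVars_update (by simp [hv]) (by simp)).symm (funext fun w => ?_)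
    by_cases hw : w = v
    · subst hw; simp [assign, hv, hz]
    · rw [assign_update _ _ _ _ _ hw]
  cases hz : a v
  · simp [key false hz]
  · simp [key true hz]

theorem Rule7.value_eq (J : (N → Bool) → ℝ) {v : N} {z : Bool} {concl prem : Term N}
    (h : Rule7 v z concl prem) (a : N → Bool) :
    concl.value J a = prem.value J (Function.update a v z) := by
  obtain ⟨hv, rfl⟩ := h
  refine value_congr (leftVars_update hv _)
    (rightVars_update (by simp [hv]) (by simp)) (funext fun w => ?_)
  by_cases hw : w = v
  · subst hw; simp [assign, hv]
  · simp [assign, hw]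

theorem Rule8.value_eq (J : (N → Bool) → ℝ) {v : N} {z : Bool} {concl prem : Term N}
    (h : Rule8 v z concl prem) (a : N → Bool) :
    concl.value J a = prem.value J (Function.update a v z) := by
  obtain ⟨hv, rfl⟩ := h
  refine value_congr ?_ ?_ (funext fun w => ?_)
  · ext w
    by_cases hw : w = v
    · subst hw; simp [hv]
    · simp [hw]
  · ext w
    by_cases hw : w = v
    · subst hw; simp [hv]
    · simp [hw]
  · by_cases hw : w = v
    · subst hw; simp [assign, hv]
    · simp [assign, hw]

end Term

/-! ### The augmented model and the values of the input and target terms. -/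

namespace LDAG.CausalModel

variable {V : Type*} {G : LDAG V}

/-- The model of the augmented LDAG in which the intervention nodes are fair coins, and the
variables on which an intervention acts become fair coins. -/
noncomputable def augment (M : G.CausalModel) : G.augment.CausalModel where
  prob
    -- A point mass would violate positivity. A constant suffices: it respects the labels at
    -- $I_v=1$, and it cancels once the intervened variables are conditioned on.
    | .inl v, a => if a (.inr v) then 1 / 2 else M.prob v fun u => a (.inl u)
    | .inr _, _ => 1 / 2
  prob_pos v a := by
    rcases v with v | v
    · dsimp only
      split
      · norm_num
      · exact M.prob_pos _ _
    · norm_num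
  prob_lt_one v a := by
    rcases v with v | v
    · dsimp only
      split
      · norm_num
      · exact M.prob_lt_one _ _
    · norm_num
  prob_parents v a b h := by
    rcases v with v | v
    · have h1 : a (.inr v) = b (.inr v) := h (.inr v) rfl
      have h2 : M.prob v (fun u => a (.inl u)) = M.prob v fun u => b (.inl u) :=
        M.prob_parents v _ _ fun u hu => h (.inl u) hu
      simp only [h1, h2]
    · rfl
  prob_label u v huv a b hab hl := by
    rcases v with v | v
    · rcases u with u | u
      · have h1 : a (.inr v) = b (.inr v) := hab _ Sum.inr_ne_inl
        rcases hl with hl | hl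
        · have h2 : a (.inr v) = true := hl
          simp only [← h1, h2, if_true]
        · have h2 : M.prob v (fun u => a (.inl u)) = M.prob v fun u => b (.inl u) :=
            M.prob_label u v huv _ _ (fun w hw => hab _ fun h => hw (Sum.inl_injective h)) hl
          simp only [h1, h2]
      · exact hl.elim
    · rfl

variable [Fintype V] [DecidableEq V] (M : G.CausalModel)

/-- The empty set is ancestral, so every variable can be summed out. -/
theorem sum_joint : ∑ a, M.joint a = 1 := by
  have := sumOver_compl_prod G.acyclic M.prob_parents ∅ (by simp) fun _ => false
  simpa [sumOver, M.joint_eq] using this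

/-- In the joint distribution of the augmented model, the event in which the interventions act on
the variables in `X` is described by the truncated factorization. -/
theorem marginal_augment {T : Finset (V ⊕ V)} {X D : Finset V} {c : V ⊕ V → Bool}
    (hl : ∀ v, .inl v ∈ T ↔ v ∈ D) (hr : ∀ v, .inr v ∈ T)
    (hc : ∀ v, c (.inr v) = decide (v ∈ X)) :
    marginal M.augment.joint T c = ((∏ _v ∈ X, (1 / 2 : ℝ)) * ∏ _v : V, (1 / 2 : ℝ)) *
      ∑ b : V → Bool with ∀ v ∈ D, b v = c (.inl v), ∏ v ∈ Xᶜ, M.cpd v b := by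
  rw [Finset.mul_sum, marginal]
  -- All intervention nodes belong to `T` and have values prescribed by `X`, so only the ordinary
  -- variables are summed. The constant collects one half for each variable in `X` and for each
  -- intervention node.
  refine Finset.sum_nbij' (fun b v => b (.inl v)) (fun b => Sum.elim b fun v => decide (v ∈ X))
    ?_ ?_ ?_ ?_ ?_
  · intro b hb
    simp only [Finset.mem_filter, Finset.mem_univ, true_and] at hb ⊢
    exact fun v hv => hb _ ((hl v).2 hv)
  · intro b hb
    simp only [Finset.mem_filter, Finset.mem_univ, true_and] at hb ⊢
    rintro (v | v) hv
    · exact hb v ((hl v).1 hv)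
    · exact (hc v).symm
  · intro b hb
    simp only [Finset.mem_filter, Finset.mem_univ, true_and] at hb
    funext v
    rcases v with v | v
    · rfl
    · simp [hb _ (hr v), hc]
  · intro b _
    rfl
  · intro b hb
    simp only [Finset.mem_filter, Finset.mem_univ, true_and] at hb
    have h1 : ∀ v, M.augment.cpd (.inr v) b = 1 / 2 := by
      intro v
      have : M.augment.prob (.inr v) b = 1 / 2 := rfl
      rw [cpd, this]
      split <;> norm_num
    have h2 : ∀ v, M.augment.cpd (.inl v) b =
        if v ∈ X then 1 / 2 else M.cpd v fun u => b (.inl u) := by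
      intro v
      have : M.augment.prob (.inl v) b =
        if b (.inr v) then 1 / 2 else M.prob v fun u => b (.inl u) := rfl
      rw [cpd, this, hb _ (hr v), hc]
      by_cases hv : v ∈ X
      · simp only [hv, decide_true, if_true]
        split <;> norm_num
      · simp [hv, cpd]
    rw [joint, Fintype.prod_sum_type, Finset.prod_congr rfl fun v _ => h1 v,
      Finset.prod_congr rfl fun v _ => h2 v, mul_right_comm]
    congr 1
    rw [← Finset.prod_mul_prod_compl X]
    congr 1
    · exact Finset.prod_congr rfl fun v hv => if_pos hv
    · exact Finset.prod_congr rfl fun v hv => if_neg (Finset.mem_compl.1 hv)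

/-- Only intervention nodes are conditioned on, so after cancelling the constant the denominator is
the total mass $1$. -/
theorem value_inputTerm (W : Finset V) (a : V ⊕ V → Bool) :
    (inputTerm W).value M.augment.joint a = M.observed W fun v => a (.inl v.1) := by
  have hc : ∀ v, (inputTerm W).assign a (.inr v) = decide (v ∈ (∅ : Finset V)) := by
    intro v; simp [Term.assign, inputTerm]
  have hc' : ∀ v, (inputTerm W).assign a (.inl v) = a (.inl v) := by
    intro v
    by_cases hv : v ∈ W <;> simp [Term.assign, inputTerm, hv]
  rw [Term.value, M.marginal_augment (X := ∅) (D := W) _ _ hc,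
    M.marginal_augment (X := ∅) (D := ∅) _ _ hc, mul_div_mul_left]
  · have h1 := M.sum_joint
    simp only [joint] at h1
    simp [observed, joint, hc', h1]
  · exact mul_ne_zero (Finset.prod_ne_zero_iff.2 fun _ _ => by norm_num)
      (Finset.prod_ne_zero_iff.2 fun _ _ => by norm_num)
  · intro v
    by_cases hv : v ∈ W <;> simp [inputTerm, hv]
  · intro v
    simp [inputTerm]
  · intro v
    by_cases hv : v ∈ W <;> simp [inputTerm, hv]
  · intro v
    simp [inputTerm]

theorem value_targetTerm {Y X Z : Finset V} (hYX : Disjoint Y X) (hYZ : Disjoint Y Z)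
    (a : V ⊕ V → Bool) :
    (targetTerm Y X Z).value M.augment.joint a = M.effect Y X Z fun v => a (.inl v) := by
  have hc : ∀ v, (targetTerm Y X Z).assign a (.inr v) = decide (v ∈ X) := by
    intro v; simp [Term.assign, targetTerm]
  have hc' : ∀ v, (targetTerm Y X Z).assign a (.inl v) = a (.inl v) := by
    intro v
    by_cases hY : v ∈ Y
    · simp [Term.assign, targetTerm, hY]
    · by_cases hv : v ∈ X ∪ Z
      · rw [Term.assign, targetTerm, if_neg hY, if_pos hv]; rfl
      · rw [Term.assign, targetTerm, if_neg hY, if_neg hv]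
  -- The indicator in the truncated factorization becomes the condition on `X` that the target term
  -- has in its numerator and denominator.
  have hdo : ∀ D : Finset V,
      ∑ b : V → Bool with ∀ v ∈ D, b v = a (.inl v), M.doJoint X (fun v => a (.inl v)) b =
        ∑ b : V → Bool with ∀ v ∈ D ∪ X, b v = a (.inl v), ∏ v ∈ Xᶜ, M.cpd v b := by
    intro D
    simp only [doJoint]
    rw [← Finset.sum_filter, Finset.filter_filter]
    refine Finset.sum_congr (Finset.filter_congr fun b _ => ?_) fun _ _ => rfl
    simp only [Finset.mem_union, or_imp, forall_and]
  rw [Term.value, M.marginal_augment (X := X) (D := Y ∪ Z ∪ X) _ _ hc,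
    M.marginal_augment (X := X) (D := Z ∪ X) _ _ hc, mul_div_mul_left, effect, hdo, hdo]
  · simp only [hc']
  · exact mul_ne_zero (Finset.prod_ne_zero_iff.2 fun _ _ => by norm_num)
      (Finset.prod_ne_zero_iff.2 fun _ _ => by norm_num)
  · intro v
    have h1 : v ∈ Y → v ∉ X := fun h => Finset.disjoint_left.1 hYX h
    have h2 : v ∈ Y → v ∉ Z := fun h => Finset.disjoint_left.1 hYZ h
    by_cases hY : v ∈ Y
    · simp [targetTerm, hY, h1 hY, h2 hY]
    · by_cases hX : v ∈ X <;> by_cases hZ : v ∈ Z <;> simp [targetTerm, hY, hX, hZ]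
  · intro v
    simp [targetTerm]
  · intro v
    by_cases hY : v ∈ Y
    · simp [targetTerm, hY]
    · by_cases hX : v ∈ X <;> by_cases hZ : v ∈ Z <;> simp [targetTerm, hY, hX, hZ]
  · intro v
    simp [targetTerm]

end LDAG.CausalModel

/-! ### Correctness of the stored expressions. -/

section Soundness

variable {V : Type*} [Fintype V] [DecidableEq V] {W : Finset V}

/-- The value of the expression is the value of the term in the distribution `J`. -/
def Formula.IsCorrect (p : ({v // v ∈ W} → Bool) → ℝ) (J : (V ⊕ V → Bool) → ℝ)
    (f : Formula (V ⊕ V)) (t : Term (V ⊕ V)) : Prop :=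
  ∀ a, f.eval p a = t.value J a

variable {p : ({v // v ∈ W} → Bool) → ℝ} {J : (V ⊕ V → Bool) → ℝ}

theorem Candidate.isCorrect_build (hJ : ∀ a, 0 < J a) {t : Term (V ⊕ V)}
    {c : Candidate (V ⊕ V)} (hvalid : c.Valid t) (hcsi : ∀ s, c.csi t = some s → s.Holds J)
    {f g : Formula (V ⊕ V)} (hf : f.IsCorrect p J t)
    (hg : ∀ u, c.extra = some u → g.IsCorrect p J u) :
    (c.build t f g).IsCorrect p J c.concl := by
  obtain ⟨rule, extra, concl⟩ := c
  obtain ⟨-, hv⟩ := hvalid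
  -- An equality of functions is needed because `sum` and `subst` evaluate `f` at assignments other
  -- than `a`.
  have hf' : f.eval p = t.value J := funext hf
  intro a
  cases rule with
  | r1Insert =>
    cases extra with
    | some u => exact hv.elim
    | none => exact (hf a).trans (Term.Rule1.value_eq hJ hv (hcsi _ rfl) a).symm
  | r1Delete =>
    cases extra with
    | some u => exact hv.elim
    | none => exact (hf a).trans (Term.Rule1.value_eq hJ hv (hcsi _ rfl) a)
  | r2 =>
    cases extra with
    | some u => exact hv.elim
    | none =>
      refine Eq.trans ?_ (Term.Rule2.value_eq J hv (S := {v | t v ≠ concl v}) (by simp) a).symm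
      rw [← hf']
      rfl
  | r3 =>
    cases extra with
    | some u => exact hv.elim
    | none =>
      refine Eq.trans ?_
        (Term.Rule3.value_eq hJ hv (S := {v | concl v = .left none}) (by simp) a).symm
      rw [← hf']
      rfl
  | r4First =>
    cases extra with
    | none => exact hv.elim
    | some u =>
      rw [Term.Rule4.value_eq hJ hv, ← hf a, ← hg u rfl a]
      rfl
  | r4Second =>
    cases extra with
    | none => exact hv.elim
    | some u =>
      rw [Term.Rule4.value_eq hJ hv, ← hf a, ← hg u rfl a]
      rfl
  | r5All v z =>
    cases extra with
    | none => exact hv.elim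
    | some u =>
      rw [Term.Rule5.value_eq J hv, ← hf a, ← hg u rfl a]
      rfl
  | r5Case v z =>
    cases extra with
    | none => exact hv.elim
    | some u =>
      rw [Term.Rule5.value_eq J hv, ← hf a, ← hg u rfl a]
      rfl
  | r5Empty v z =>
    cases extra with
    | some u => exact hv.elim
    | none =>
      rw [Term.Rule5.value_eq J hv.2, ← hf a, Term.value_eq_one hJ]
      · rfl
      · intro w o h
        by_cases hw : w = v
        · subst hw; simp at h
        · rw [Function.update_of_ne hw] at h
          exact hv.1 w o hw h
  | r6Zero v =>
    cases extra with
    | none => exact hv.elim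
    | some u =>
      rw [Term.Rule6.value_eq J hv, ← hf a, ← hg u rfl a]
      rfl
  | r6One v =>
    cases extra with
    | none => exact hv.elim
    | some u =>
      rw [Term.Rule6.value_eq J hv, ← hf a, ← hg u rfl a]
      rfl
  | r7 v z =>
    cases extra with
    | some u => exact hv.elim
    | none =>
      rw [Term.Rule7.value_eq J hv, ← hf]
      rfl
  | r8 v z =>
    cases extra with
    | some u => exact hv.elim
    | none =>
      rw [Term.Rule8.value_eq J hv, ← hf]
      rfl

theorem Candidate.Valid.csi_isDisjoint {N : Type*} [Fintype N] [DecidableEq N] {t : Term N}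
    {c : Candidate N} (hvalid : c.Valid t) {s : CSI N} (hs : c.csi t = some s) :
    s.IsDisjoint := by
  obtain ⟨rule, extra, concl⟩ := c
  obtain ⟨-, hv⟩ := hvalid
  cases rule with
  | r1Insert =>
    cases extra with
    | some u => exact hv.elim
    | none =>
      obtain rfl := Option.some.inj hs
      exact Term.Rule1.csi_isDisjoint hv
  | r1Delete =>
    cases extra with
    | some u => exact hv.elim
    | none =>
      obtain rfl := Option.some.inj hs
      exact Term.Rule1.csi_isDisjoint hv
  | _ => simp [Candidate.csi] at hs

/-- All identified terms have a correct expression. -/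
def SearchState.IsCorrect (p : ({v // v ∈ W} → Bool) → ℝ) (J : (V ⊕ V → Bool) → ℝ)
    (st : SearchState (V ⊕ V)) : Prop :=
  ∀ t f, st.identified t = some f → f.IsCorrect p J t

/-- Correctness of all stored expressions is the loop invariant; validity of the candidates supplies
the disjointness that soundness of the test requires. -/
theorem processCandidates_sound {G : LDAG (V ⊕ V)} (σ : Strategy G) (M : G.CausalModel)
    {n : ℕ} {Q t : Term (V ⊕ V)} {cs : List (Candidate (V ⊕ V))} (hcs : ∀ c ∈ cs, c.Valid t)
    {st : SearchState (V ⊕ V)} (hst : st.IsCorrect p M.joint)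
    {r : SearchState (V ⊕ V) ⊕ Formula (V ⊕ V)}
    (h : processCandidates σ n Q t cs st = some r) :
    (∀ st', r = .inl st' → st'.IsCorrect p M.joint) ∧
      ∀ F, r = .inr F → F.IsCorrect p M.joint Q := by
  induction cs generalizing st with
  | nil =>
    obtain rfl := Option.some.inj h
    refine ⟨?_, by simp⟩
    rintro st' h
    obtain rfl := Sum.inl_injective h
    exact hst
  | cons c cs ih =>
    have ih := fun {st} => ih (st := st) fun c hc => hcs c (List.mem_cons_of_mem _ hc)
    rw [processCandidates] at h
    split at h
    swap
    · exact ih hst h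
    rename_i f g _ hf hg
    split at h
    · simp at h
    · exact ih hst h
    rename_i htest
    have hvalid := hcs c List.mem_cons_self
    have hbuild : (c.build t f g).IsCorrect p M.joint c.concl := by
      refine Candidate.isCorrect_build M.joint_pos hvalid (fun s hs => ?_) (hst t f hf) ?_
      · rw [hs] at htest
        exact testCSI_sound σ M n ∅ s (hvalid.csi_isDisjoint hs) htest
      · intro u hu
        rw [SearchState.extraFormula, hu] at hg
        exact hst u g hg
    split at h
    · rename_i hQ
      obtain rfl := Option.some.inj h
      refine ⟨by simp, ?_⟩
      rintro F h
      obtain rfl := Sum.inr_injective h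
      exact hQ ▸ hbuild
    · refine ih ?_ h
      intro u f' hu
      by_cases huc : u = c.concl
      · subst huc
        obtain rfl : c.build t f g = f' := by simpa [SearchState.add] using hu
        exact hbuild
      · exact hst u f' (by simpa [SearchState.add, huc] using hu)

/-- An expression that is returned by the search is correct. -/
theorem searchLoop_sound {G : LDAG (V ⊕ V)} (σ : Strategy G) (M : G.CausalModel)
    {n m : ℕ} {Q : Term (V ⊕ V)} {st : SearchState (V ⊕ V)} (hst : st.IsCorrect p M.joint)
    {F : Formula (V ⊕ V)} (h : searchLoop σ n Q m st = some (some F)) :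
    F.IsCorrect p M.joint Q := by
  induction m generalizing st with
  | zero => simp [searchLoop] at h
  | succ m ih =>
    rw [searchLoop] at h
    split at h
    · simp at h
    rename_i t _
    have := fun {r} => processCandidates_sound σ M (n := n) (Q := Q)
      (fun c hc => (σ.mem_candidates t c).1 hc) hst (r := r)
    split at h
    · simp at h
    · rename_i F' hF
      obtain rfl : F' = F := by simpa using h
      exact (this hF).2 _ rfl
    · rename_i st' hst'
      exact ih (st := { st' with unexpanded := st'.unexpanded.erase t })
        (fun u f hu => (this hst').1 _ rfl u f hu) h

end Soundness

/-! ### Termination of the search. -/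

section Termination

variable {N : Type*} [Fintype N] [DecidableEq N] {G : LDAG N}

/-- The number of unidentified terms plus the number of unexpanded terms. -/
noncomputable def SearchState.remaining (st : SearchState N) : ℕ :=
  {t | st.identified t = none}.ncard + st.unexpanded.length

/-- The term leaves one of the two counts and enters the other. -/
theorem SearchState.remaining_add {st : SearchState N} {t : Term N} (ht : st.identified t = none)
    (f : Formula N) : (st.add t f).remaining = st.remaining := by
  have h : {u | (st.add t f).identified u = none} = {u | st.identified u = none} \ {t} := by
    ext u
    by_cases hu : u = t <;> simp [SearchState.add, hu]
  have := Set.ncard_sdiff_singleton_add_one (s := {u | st.identified u = none}) ht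
  have hlen : (st.add t f).unexpanded.length = st.unexpanded.length + 1 := List.length_append
  rw [SearchState.remaining, SearchState.remaining, h, hlen]
  omega

/-- The depth bound is that of a test in which no node is used yet. The inclusion ensures that the
expanded term is still present when it is to be erased. -/
theorem processCandidates_eventually (σ : Strategy G) (Q t : Term N) (cs : List (Candidate N))
    (st : SearchState N) :
    ∃ r, (∀ n ≥ Fintype.card N + 1, processCandidates σ n Q t cs st = some r) ∧
      ∀ st', r = .inl st' → st'.remaining = st.remaining ∧ st.unexpanded ⊆ st'.unexpanded := by
  induction cs generalizing st with
  | nil =>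
    refine ⟨.inl st, fun n _ => rfl, ?_⟩
    rintro st' h
    obtain rfl := Sum.inl_injective h
    exact ⟨rfl, List.Subset.refl _⟩
  | cons c cs ih =>
    simp only [processCandidates]
    split
    swap
    · exact ih st
    rename_i f g hnone _ _
    obtain ⟨b, hb⟩ : ∃ b, ∀ n ≥ Fintype.card N + 1,
        (c.csi t).elim (some true) (testCSI σ n ∅) = some b := by
      cases c.csi t with
      | none => exact ⟨true, fun _ _ => rfl⟩
      | some s => simpa using testCSI_eventually σ ∅ s
    cases b with
    | false =>
      obtain ⟨r, hr, hr'⟩ := ih st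
      exact ⟨r, fun n hn => by rw [hb n hn]; exact hr n hn, hr'⟩
    | true =>
      by_cases hQ : c.concl = Q
      · exact ⟨.inr (c.build t f g), fun n hn => by rw [hb n hn]; exact if_pos hQ, by simp⟩
      · obtain ⟨r, hr, hr'⟩ := ih (st.add c.concl (c.build t f g))
        refine ⟨r, fun n hn => ?_, fun st' h => ?_⟩
        · rw [hb n hn]
          exact (if_neg hQ).trans (hr n hn)
        · obtain ⟨h1, h2⟩ := hr' st' h
          refine ⟨h1.trans (SearchState.remaining_add hnone _), fun u hu => h2 ?_⟩
          exact List.mem_append_left _ hu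

/-- The search terminates. -/
theorem searchLoop_eventually (σ : Strategy G) (Q : Term N) (st : SearchState N) :
    ∃ r, ∀ n ≥ Fintype.card N + 1, ∀ m > st.remaining, searchLoop σ n Q m st = some r := by
  induction h : st.remaining using Nat.strong_induction_on generalizing st with
  | _ k ih =>
  subst h
  suffices ∃ r, ∀ n ≥ Fintype.card N + 1, ∀ m ≥ st.remaining,
      searchLoop σ n Q (m + 1) st = some r by
    obtain ⟨r, hr⟩ := this
    refine ⟨r, fun n hn m hm => ?_⟩
    obtain ⟨m, rfl⟩ : ∃ l, m = l + 1 := ⟨m - 1, by omega⟩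
    exact hr n hn m (by omega)
  simp only [searchLoop]
  cases ht : st.unexpanded.argmax σ.proximity with
  | none => exact ⟨none, fun _ _ _ _ => rfl⟩
  | some t =>
    have htmem : t ∈ st.unexpanded := List.argmax_mem ht
    obtain ⟨r, hr, hr'⟩ := processCandidates_eventually σ Q t (σ.candidates t) st
    cases r with
    | inr F => exact ⟨some F, fun n hn m _ => by simp only [hr n hn]⟩
    | inl st' =>
      obtain ⟨h1, h2⟩ := hr' st' rfl
      have hlen := List.length_erase_of_mem (h2 htmem)
      have hpos := List.length_pos_of_mem (h2 htmem)
      -- The candidate loop preserves the measure, and erasing the expanded term lowers it by one.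
      have hlt : ({ st' with unexpanded := st'.unexpanded.erase t } : SearchState N).remaining <
          st.remaining := by
        rw [← h1]
        simp only [SearchState.remaining, hlen]
        omega
      obtain ⟨r, hr''⟩ := ih _ hlt _ rfl
      exact ⟨r, fun n hn m hm => by simp only [hr n hn]; exact hr'' n hn m (by omega)⟩

end Termination

/-! ### The main theorem. -/

theorem theorem4 {V : Type*} [Fintype V] [DecidableEq V] (G : LDAG V)
    (W Y X Z : Finset V) (hY : Y ⊆ W) (hX : X ⊆ W) (hZ : Z ⊆ W)
    (hYX : Disjoint Y X) (hYZ : Disjoint Y Z) (hXZ : Disjoint X Z)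
    (σ : Strategy G.augment) :
    (∃ (N : ℕ) (r : Option (Formula (V ⊕ V))), ∀ n ≥ N, search G σ W Y X Z n = some r) ∧
      ∀ (n : ℕ) (F : Formula (V ⊕ V)), search G σ W Y X Z n = some (some F) →
        ∀ (M : G.CausalModel) (a : V ⊕ V → Bool),
          F.eval (M.observed W) a = M.effect Y X Z (fun v => a (.inl v)) := by
  constructor
  · obtain ⟨r, hr⟩ := searchLoop_eventually σ (targetTerm Y X Z)
      { identified := Function.update (fun _ => none) (inputTerm W) (some .input)
        unexpanded := [inputTerm W] }
    -- The single bound `n` serves as test depth and as iteration count, so the threshold is the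
    -- maximum of the two.
    exact ⟨_, r, fun n hn => hr n (le_of_max_le_left hn) n
      (Nat.lt_of_succ_le (le_of_max_le_right hn))⟩
  · intro n F hF M a
    have hinit : SearchState.IsCorrect (M.observed W) M.augment.joint
        { identified := Function.update (fun _ => none) (inputTerm W) (some .input)
          unexpanded := [inputTerm W] } := by
      intro t f ht
      by_cases h : t = inputTerm W
      · subst h
        obtain rfl : Formula.input = f := by simpa using ht
        exact fun b => (M.value_inputTerm W b).symm
      · simp [h] at ht
    rw [searchLoop_sound σ M.augment hinit hF a, M.value_targetTerm hYX hYZ]
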